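/- Let $\Bbbk$ be a field of characteristic zero. Let $c\mathsf{Com}$ be the category of cosimplicial commutative $\Bbbk$-algebras and $\mathsf{cdga}$ the category of commutative dg $\Bbbk$-algebras, cohomologically graded in non-negative degrees. For $n\ge 0$ let $\Lambda^n=\Bbbk[e_0,\dots,e_n]$ be the free graded commutative algebra on generators of degree $-1$, with the derivation $e_i\mapsto 1$ as differential; a map $\alpha\colon[m]\to[n]$ acts by $e_i\mapsto e_{\alpha(i)}$. Let $K^\bullet_{\mathrm{alg}}\colon \mathsf{cdga}\to c\mathsf{Com}$ be the Dold–Kan functor $K^n_{\mathrm{alg}}(C)=Z^0(C\otimes\Lambda^n)$. It has a left adjoint $D^\ast$. A cosimplicial algebra $A^\bullet$ is *reduced* if $A^0=\Bbbk$; then $\mathfrak m^n_A=\ker(A^n\to A^0)$ is its augmentation ideal, and $\widehat A^\bullet$, with $\widehat A^n=\varprojlim_i A^n/(\mathfrak m_A^n)^i$, is its completion. Let $c\mathsf{Com}_0\subset c\mathsf{Com}$ be the full subcategory of reduced objects, and $c\mathsf{Com}^{\mathrm{fg}}_0$ that of the reduced $A^\bullet$ such that every $A^n$ is a finitely generated $\Bbbk$-algebra.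 Let $c\widehat{\mathsf{Alg}}_0$ be the category of reduced cosimplicial objects in complete local Noetherian $\Bbbk$-algebras with residue field $\Bbbk$. A cdga $C$ is *reduced* if $C^0=\Bbbk$; let $\mathsf{cdga}^{\mathrm{fg}}_0$ be the full subcategory of reduced cdgas with $\dim_\Bbbk C^i<\infty$ for all $i\ge 1$. Then: 1. $D^\ast$ maps $c\mathsf{Com}^{\mathrm{fg}}_0$ into $\mathsf{cdga}^{\mathrm{fg}}_0$ and $K^\bullet_{\mathrm{alg}}$ maps $\mathsf{cdga}^{\mathrm{fg}}_0$ into $c\mathsf{Com}^{\mathrm{fg}}_0$, and the adjunction $D^\ast\dashv K^\bullet_{\mathrm{alg}}$ restricts (with the same unit and counit) to an adjunction $D^\ast\colon c\mathsf{Com}^{\mathrm{fg}}_0\rightleftarrows \mathsf{cdga}^{\mathrm{fg}}_0\colon K^\bullet_{\mathrm{alg}}$. 2. If $A^\bullet\in c\mathsf{Com}_0$, then $D^\ast(A^\bullet)$ and $D^\ast(\widehat A^\bullet)$ are reduced cdgas. If moreover every ideal $\mathfrak m_A^n\subseteq A^n$ is finitely generated (in particular, if $A^\bullet\in c\mathsf{Com}^{\mathrm{fg}}_0$),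 then the canonical map $A^\bullet\to\widehat A^\bullet$ induces an isomorphism $D^\ast(\widehat A^\bullet)\cong D^\ast(A^\bullet)$, natural in $A^\bullet$. 3. The adjunction of (1) extends along the completion functor: completion maps $c\mathsf{Com}^{\mathrm{fg}}_0$ into $c\widehat{\mathsf{Alg}}_0$, $D^\ast$ maps $c\widehat{\mathsf{Alg}}_0$ into $\mathsf{cdga}^{\mathrm{fg}}_0$, $K^\bullet_{\mathrm{alg}}$ maps $\mathsf{cdga}^{\mathrm{fg}}_0$ into $c\widehat{\mathsf{Alg}}_0$, and $D^\ast\dashv K^\bullet_{\mathrm{alg}}$ restricts (with the same unit and counit) to an adjunction $D^\ast\colon c\widehat{\mathsf{Alg}}_0\rightleftarrows \mathsf{cdga}^{\mathrm{fg}}_0\colon K^\bullet_{\mathrm{alg}}$. There are natural isomorphisms $D^\ast(\widehat A^\bullet)\cong D^\ast(A^\bullet)$ for $A^\bullet\in c\mathsf{Com}^{\mathrm{fg}}_0$ and $\widehat{K^\bullet_{\mathrm{alg}}(C)}\cong K^\bullet_{\mathrm{alg}}(C)$ for $C\in\mathsf{cdga}^{\mathrm{fg}}_0$, both induced by the canonical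 map to the completion. -/

import Mathlib

open CategoryTheory TensorProduct

universe u

noncomputable section

namespace CosimplicialDK

/-! ### Commutative dg algebras -/

/-- A commutative differential graded algebra over `k`, cohomologically graded and concentrated in
non-negative degrees: the underlying algebra is the direct sum of the submodules `deg n`. -/
structure CDGA (k : Type u) [Field k] where
  carrier : Type u
  [ring : Ring carrier]
  [algebra : Algebra k carrier]
  deg : ℕ → Submodule k carrier
  [graded : GradedAlgebra deg]
  d : carrier →ₗ[k] carrier
  d_mem : ∀ (n : ℕ) (x : carrier), x ∈ deg n → d x ∈ deg (n + 1)
  d_d : ∀ x : carrier, d (d x) = 0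
  leibniz : ∀ (m : ℕ) (x y : carrier), x ∈ deg m → d (x * y) = d x * y + (-1 : k) ^ m • (x * d y)
  comm : ∀ (m n : ℕ) (x y : carrier), x ∈ deg m → y ∈ deg n →
    x * y = (-1 : k) ^ (m * n) • (y * x)

attribute [instance] CDGA.ring CDGA.algebra CDGA.graded

variable {k : Type u} [Field k]

/-- Morphisms of cdgas: unital algebra morphisms of degree zero that commute with `d`. -/
@[ext]
structure CDGA.Hom (C D : CDGA k) where
  toAlgHom : C.carrier →ₐ[k] D.carrier
  map_deg : ∀ (n : ℕ) (x : C.carrier), x ∈ C.deg n → toAlgHom x ∈ D.deg n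
  map_d : ∀ x : C.carrier, toAlgHom (C.d x) = D.d (toAlgHom x)

instance : Category (CDGA k) where
  Hom := CDGA.Hom
  id C := ⟨AlgHom.id k C.carrier, fun _ _ h => h, fun _ => rfl⟩
  comp f g := ⟨g.toAlgHom.comp f.toAlgHom, fun n x h => g.map_deg n _ (f.map_deg n x h),
    fun x => by simp [f.map_d, g.map_d]⟩

/-- The linear map that is multiplication by `(-1) ^ n` in degree `n`. -/
def CDGA.sign (C : CDGA k) : C.carrier →ₗ[k] C.carrier :=
  (DirectSum.toModule k ℕ C.carrier fun n => (-1 : k) ^ n • (C.deg n).subtype) ∘ₗ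
    (DirectSum.decomposeLinearEquiv C.deg).toLinearMap

lemma CDGA.sign_apply (C : CDGA k) {n : ℕ} {x : C.carrier} (hx : x ∈ C.deg n) :
    C.sign x = (-1 : k) ^ n • x := by
  simp only [CDGA.sign, LinearMap.comp_apply, LinearEquiv.coe_coe,
    DirectSum.decomposeLinearEquiv_apply, DirectSum.decompose_of_mem _ hx]
  rw [← DirectSum.lof_eq_of k, DirectSum.toModule_lof]
  simp

/-! ### The cosimplicial cdga `Λ` -/

/-- `Λⁿ = k[e₀, …, eₙ]`, the free graded commutative algebra on generators of degree `-1`. The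
piece of degree `-i` is the `i`-th exterior power. -/
abbrev Lam (k : Type u) [Field k] (n : SimplexCategory) : Type u :=
  ExteriorAlgebra k (Fin (n.len + 1) →₀ k)

/-- `lamDeg k n i` is the part of `Λⁿ` of cohomological degree `-i`. -/
abbrev lamDeg (k : Type u) [Field k] (n : SimplexCategory) (i : ℕ) : Submodule k (Lam k n) :=
  ⋀[k]^i (Fin (n.len + 1) →₀ k)

/-- The functional with value `1` on each of the generators. -/
def lamFunctional (k : Type u) [Field k] (n : SimplexCategory) :
    Module.Dual k (Fin (n.len + 1) →₀ k) :=
  Finsupp.linearCombination k fun _ => (1 : k)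

/-- The differential of `Λⁿ`: the derivation sending each generator to `1`. -/
def lamD (k : Type u) [Field k] (n : SimplexCategory) : Lam k n →ₗ[k] Lam k n :=
  CliffordAlgebra.contractLeft (Q := 0) (lamFunctional k n)

/-- The algebra morphism `Λᵐ → Λⁿ`, `eᵢ ↦ e_{α i}`. -/
def lamMap (k : Type u) [Field k] {m n : SimplexCategory} (α : m ⟶ n) : Lam k m →ₐ[k] Lam k n :=
  ExteriorAlgebra.map (Finsupp.lmapDomain k k α.toOrderHom)

section Lam

variable {n : SimplexCategory}

lemma involute_of_mem {i : ℕ} {a : Lam k n} (ha : a ∈ lamDeg k n i) :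
    CliffordAlgebra.involute a = (-1 : k) ^ i • a := by
  induction ha using Submodule.pow_induction_on_left' with
  | algebraMap r => simp
  | add x y i hx hy h1 h2 => simp [h1, h2]
  | mem_mul m hm i x hx h =>
    obtain ⟨v, rfl⟩ := hm
    rw [map_mul, h]
    have : CliffordAlgebra.involute (ExteriorAlgebra.ι k v) = - ExteriorAlgebra.ι k v :=
      CliffordAlgebra.involute_ι _
    rw [this, pow_succ]
    simp

lemma iota_mul (v : Fin (n.len + 1) →₀ k) (b : Lam k n) :
    ExteriorAlgebra.ι k v * b = CliffordAlgebra.involute b * ExteriorAlgebra.ι k v := by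
  induction b using CliffordAlgebra.left_induction with
  | algebraMap r => simp [Algebra.commutes]
  | add x y h1 h2 => simp [mul_add, add_mul, h1, h2]
  | ι_mul x w h =>
    have hs : ExteriorAlgebra.ι k v * ExteriorAlgebra.ι k w =
        - (ExteriorAlgebra.ι k w * ExteriorAlgebra.ι k v) :=
      eq_neg_of_add_eq_zero_left (ExteriorAlgebra.ι_add_mul_swap v w)
    rw [map_mul, CliffordAlgebra.involute_ι, mul_assoc, ← h, ← mul_assoc, ← mul_assoc]
    change ExteriorAlgebra.ι k v * ExteriorAlgebra.ι k w * x =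
      - ExteriorAlgebra.ι k w * ExteriorAlgebra.ι k v * x
    rw [hs, neg_mul (ExteriorAlgebra.ι k w)]

lemma lam_comm {i j : ℕ} {a b : Lam k n} (ha : a ∈ lamDeg k n i) (hb : b ∈ lamDeg k n j) :
    a * b = (-1 : k) ^ (i * j) • (b * a) := by
  induction ha using Submodule.pow_induction_on_left' with
  | algebraMap r => simp [Algebra.commutes]
  | add x y i hx hy h1 h2 => simp [add_mul, mul_add, h1, h2]
  | mem_mul m hm i x hx h =>
    obtain ⟨v, rfl⟩ := hm
    rw [mul_assoc, h, mul_smul_comm, ← mul_assoc, iota_mul, involute_of_mem hb,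
      smul_mul_assoc, smul_mul_assoc, smul_smul, mul_assoc, ← pow_add]
    congr 2
    rw [Nat.succ_eq_add_one, add_mul, one_mul]

lemma lamD_mul (a b : Lam k n) :
    lamD k n (a * b) = lamD k n a * b + CliffordAlgebra.involute a * lamD k n b := by
  unfold lamD
  induction a using CliffordAlgebra.left_induction with
  | algebraMap r => simp [CliffordAlgebra.contractLeft_algebraMap_mul]
  | add x y h1 h2 => simp only [add_mul, map_add, h1, h2]; abel
  | ι_mul x v h =>
    rw [mul_assoc, CliffordAlgebra.contractLeft_ι_mul, h, CliffordAlgebra.contractLeft_ι_mul,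
      map_mul, CliffordAlgebra.involute_ι]
    simp only [mul_add, sub_mul, smul_mul_assoc, neg_mul, mul_assoc]
    abel

lemma lamMap_lamD {m : SimplexCategory} (α : m ⟶ n) (a : Lam k m) :
    lamMap k α (lamD k m a) = lamD k n (lamMap k α a) := by
  unfold lamD
  induction a using CliffordAlgebra.left_induction with
  | algebraMap r => 
    rw [CliffordAlgebra.contractLeft_algebraMap, map_zero, AlgHom.commutes]
    exact (CliffordAlgebra.contractLeft_algebraMap (Q := 0) _ _).symm
  | add x y h1 h2 => simp only [map_add, h1, h2]
  | ι_mul x v h =>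
    have hv : lamMap k α (CliffordAlgebra.ι 0 v) =
        CliffordAlgebra.ι 0 (Finsupp.lmapDomain k k α.toOrderHom v) :=
      ExteriorAlgebra.map_apply_ι _ _
    have hf : lamFunctional k n (Finsupp.lmapDomain k k α.toOrderHom v) = lamFunctional k m v := by
      simp only [lamFunctional, Finsupp.lmapDomain_apply, Finsupp.linearCombination_mapDomain]
      rfl
    rw [CliffordAlgebra.contractLeft_ι_mul, map_sub, map_smul, map_mul, map_mul, hv, h,
      CliffordAlgebra.contractLeft_ι_mul, hf]

lemma lamMap_mem {m : SimplexCategory} (α : m ⟶ n) {i : ℕ} {a : Lam k m} (ha : a ∈ lamDeg k m i) :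
    lamMap k α a ∈ lamDeg k n i := by
  induction ha using Submodule.pow_induction_on_left' with
  | algebraMap r => rw [AlgHom.commutes]; exact SetLike.algebraMap_mem_graded (lamDeg k n) r
  | add x y i hx hy h1 h2 => rw [map_add]; exact add_mem h1 h2
  | mem_mul m hm i x hx h =>
    obtain ⟨v, rfl⟩ := hm
    have h2 : lamDeg k n i.succ = LinearMap.range (ExteriorAlgebra.ι k) * lamDeg k n i :=
      pow_succ' _ _
    rw [map_mul, h2]
    refine Submodule.mul_mem_mul ?_ h
    rw [lamMap, ExteriorAlgebra.map_apply_ι]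
    exact ⟨_, rfl⟩

lemma lamMap_id (a : Lam k n) : lamMap k (𝟙 n) a = a := by
  have : Finsupp.lmapDomain k k (SimplexCategory.Hom.toOrderHom (𝟙 n)) =
      (LinearMap.id : (Fin (n.len + 1) →₀ k) →ₗ[k] _) := by
    rw [← Finsupp.lmapDomain_id]; rfl
  rw [lamMap, this, ExteriorAlgebra.map_id]; rfl

lemma lamMap_comp {l m : SimplexCategory} (α : l ⟶ m) (β : m ⟶ n) (a : Lam k l) :
    lamMap k (α ≫ β) a = lamMap k β (lamMap k α a) := by
  rw [lamMap, lamMap, lamMap, ← AlgHom.comp_apply, ExteriorAlgebra.map_comp_map,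
    ← Finsupp.lmapDomain_comp]
  rfl

lemma lamD_mem_aux {i : ℕ} {x : Lam k n} (hx : x ∈ lamDeg k n i) :
    (i = 0 → lamD k n x = 0) ∧ ∀ j, i = j + 1 → lamD k n x ∈ lamDeg k n j := by
  induction hx using Submodule.pow_induction_on_left' with
  | algebraMap r =>
    exact ⟨fun _ => CliffordAlgebra.contractLeft_algebraMap (Q := 0) _ _, fun j h => by omega⟩
  | add x y i hx hy h1 h2 =>
    exact ⟨fun h => by rw [map_add, h1.1 h, h2.1 h, add_zero],
      fun j h => by rw [map_add]; exact add_mem (h1.2 j h) (h2.2 j h)⟩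
  | mem_mul m hm i x hx h =>
    obtain ⟨v, rfl⟩ := hm
    refine ⟨fun h => by omega, fun j hj => ?_⟩
    obtain rfl : i = j := by omega
    have h2 : lamD k n (ExteriorAlgebra.ι k v * x) =
        lamFunctional k n v • x - ExteriorAlgebra.ι k v * lamD k n x :=
      CliffordAlgebra.contractLeft_ι_mul (Q := 0) (d := lamFunctional k n) v x
    rw [h2]
    refine sub_mem (Submodule.smul_mem _ _ hx) ?_
    cases i with
    | zero => rw [h.1 rfl, mul_zero]; exact zero_mem _
    | succ i =>
      have h3 : lamDeg k n (i + 1) = LinearMap.range (ExteriorAlgebra.ι k) * lamDeg k n i :=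
        pow_succ' _ _
      rw [h3]
      exact Submodule.mul_mem_mul ⟨v, rfl⟩ (h.2 i rfl)

lemma lamD_mem {i : ℕ} {x : Lam k n} (hx : x ∈ lamDeg k n (i + 1)) :
    lamD k n x ∈ lamDeg k n i :=
  (lamD_mem_aux hx).2 i rfl

lemma lamD_zero {x : Lam k n} (hx : x ∈ lamDeg k n 0) : lamD k n x = 0 :=
  (lamD_mem_aux hx).1 rfl

end Lam

/-! ### The functor `K` -/

section K

open scoped TensorProduct

variable (C : CDGA k) (n : SimplexCategory)

/-- The tensor product `C ⊗ Λⁿ` of graded algebras, with the Koszul sign in the multiplication: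
`(a ⊗ x) (b ⊗ y) = (-1) ^ (|x| |b|) (a b ⊗ x y)`. -/
abbrev TensorLam : Type u := C.deg ᵍ⊗[k] (lamDeg k n)

/-- The total differential `d (a ⊗ x) = d a ⊗ x + (-1) ^ |a| a ⊗ d x`. -/
def tensorD : TensorLam C n →ₗ[k] TensorLam C n :=
  (GradedTensorProduct.of k C.deg (lamDeg k n)).toLinearMap ∘ₗ
    (TensorProduct.map C.d LinearMap.id + TensorProduct.map C.sign (lamD k n)) ∘ₗ
      (GradedTensorProduct.of k C.deg (lamDeg k n)).symm.toLinearMap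

/-- The element `a ⊗ x` of `C ⊗ Λⁿ`. -/
def tm (a : C.carrier) (x : Lam k n) : TensorLam C n :=
  GradedTensorProduct.of k C.deg (lamDeg k n) (a ⊗ₜ[k] x)

/-- The part of `C ⊗ Λⁿ` of total degree zero. -/
def tensorZero : Submodule k (TensorLam C n) :=
  Submodule.span k {t | ∃ (i : ℕ) (a : C.carrier) (x : Lam k n),
    a ∈ C.deg i ∧ x ∈ lamDeg k n i ∧ t = tm C n a x}

variable {C n}

lemma add_tm (a b : C.carrier) (x : Lam k n) : tm C n (a + b) x = tm C n a x + tm C n b x := by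
  simp [tm, TensorProduct.add_tmul]

lemma tm_add (a : C.carrier) (x y : Lam k n) : tm C n a (x + y) = tm C n a x + tm C n a y := by
  simp [tm, TensorProduct.tmul_add]

lemma smul_tm (r : k) (a : C.carrier) (x : Lam k n) : tm C n (r • a) x = r • tm C n a x := by
  rw [tm, tm, ← TensorProduct.smul_tmul', map_smul]

lemma tm_smul (r : k) (a : C.carrier) (x : Lam k n) : tm C n a (r • x) = r • tm C n a x := by
  rw [tm, tm, TensorProduct.tmul_smul, map_smul]

lemma tm_zero (a : C.carrier) : tm C n a 0 = 0 := by
  rw [tm, TensorProduct.tmul_zero, map_zero]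

lemma tm_mul_tm {j i : ℕ} (a : C.carrier) {x : Lam k n} (hx : x ∈ lamDeg k n j)
    {b : C.carrier} (hb : b ∈ C.deg i) (y : Lam k n) :
    (tm C n a x * tm C n b y) =
      (-1 : k) ^ (j * i) • tm C n (a * b) (x * y) := by
  have h := GradedTensorProduct.tmul_coe_mul_coe_tmul C.deg (lamDeg k n) a ⟨x, hx⟩ ⟨b, hb⟩ y
  refine h.trans ?_
  change (-1 : ℤˣ) ^ (j * i) • tm C n (a * b) (x * y) = _
  rcases Nat.even_or_odd (j * i) with he | ho
  · rw [he.neg_one_pow, he.neg_one_pow, one_smul, one_smul]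
  · rw [ho.neg_one_pow, ho.neg_one_pow, neg_smul, one_smul, Units.neg_smul, one_smul]

lemma tensorD_tm {i : ℕ} {a : C.carrier} (ha : a ∈ C.deg i) (x : Lam k n) :
    tensorD C n (tm C n a x) = tm C n (C.d a) x + (-1 : k) ^ i • (tm C n a (lamD k n x)) := by
  have : tensorD C n (tm C n a x) = tm C n (C.d a) x + tm C n (C.sign a) (lamD k n x) := rfl
  rw [this, C.sign_apply ha, smul_tm]

lemma tensorZero_one : (1 : TensorLam C n) ∈ tensorZero C n :=
  Submodule.subset_span ⟨0, 1, 1, SetLike.one_mem_graded _, SetLike.one_mem_graded _, rfl⟩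

lemma tensorZero_mul {s t : TensorLam C n} (hs : s ∈ tensorZero C n) (ht : t ∈ tensorZero C n) :
    s * t ∈ tensorZero C n := by
  induction hs, ht using Submodule.span_induction₂ with
  | mem_mem s t hs ht =>
    obtain ⟨i, a, x, ha, hx, rfl⟩ := hs
    obtain ⟨j, b, y, hb, hy, rfl⟩ := ht
    rw [tm_mul_tm a hx hb y]
    exact Submodule.smul_mem _ _ (Submodule.subset_span
      ⟨i + j, _, _, SetLike.mul_mem_graded ha hb, SetLike.mul_mem_graded hx hy, rfl⟩)
  | zero_left y hy => simp
  | zero_right x hx => simp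
  | add_left x y z _ _ _ h1 h2 => rw [add_mul]; exact add_mem h1 h2
  | add_right x y z _ _ _ h1 h2 => rw [mul_add]; exact add_mem h1 h2
  | smul_left r x y _ _ h => rw [smul_mul_assoc]; exact Submodule.smul_mem _ _ h
  | smul_right r x y _ _ h => rw [mul_smul_comm]; exact Submodule.smul_mem _ _ h

lemma tensorZero_comm {s t : TensorLam C n} (hs : s ∈ tensorZero C n) (ht : t ∈ tensorZero C n) :
    s * t = t * s := by
  induction hs, ht using Submodule.span_induction₂ with
  | mem_mem s t hs ht =>
    obtain ⟨i, a, x, ha, hx, rfl⟩ := hs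
    obtain ⟨j, b, y, hb, hy, rfl⟩ := ht
    rw [tm_mul_tm a hx hb y, tm_mul_tm b hy ha x, C.comm i j a b ha hb, lam_comm hx hy]
    simp only [tm_smul, smul_tm, smul_smul]
    congr 1
    rw [mul_comm j i, ← pow_add, ← pow_add]
    rcases Nat.even_or_odd (i * j) with he | ho
    · simp [pow_add, he.neg_one_pow]
    · simp [pow_add, ho.neg_one_pow]
  | zero_left y hy => simp
  | zero_right x hx => simp
  | add_left x y z _ _ _ h1 h2 => rw [add_mul, mul_add, h1, h2]
  | add_right x y z _ _ _ h1 h2 => rw [add_mul, mul_add, h1, h2]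
  | smul_left r x y _ _ h => rw [smul_mul_assoc, mul_smul_comm, h]
  | smul_right r x y _ _ h => rw [smul_mul_assoc, mul_smul_comm, h]

lemma tensorD_mul {s t : TensorLam C n} (hs : s ∈ tensorZero C n) (ht : t ∈ tensorZero C n) :
    tensorD C n (s * t) = tensorD C n s * t + s * tensorD C n t := by
  induction hs, ht using Submodule.span_induction₂ with
  | mem_mem s t hs ht =>
    obtain ⟨i, a, x, ha, hx, rfl⟩ := hs
    obtain ⟨j, b, y, hb, hy, rfl⟩ := ht
    rw [tm_mul_tm a hx hb y, map_smul, tensorD_tm (SetLike.mul_mem_graded ha hb),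
      tensorD_tm ha, tensorD_tm hb, C.leibniz i a b ha, lamD_mul, involute_of_mem hx,
      add_mul, mul_add, smul_mul_assoc, mul_smul_comm, tm_mul_tm _ hx hb y,
      tm_mul_tm a hx (C.d_mem j b hb) y, tm_mul_tm a hx hb (lamD k n y)]
    cases i with
    | zero =>
      rw [lamD_zero hx]
      simp only [tm_zero, add_tm, zero_mul, smul_zero, zero_add, pow_zero, one_smul]
      module
    | succ i =>
      rw [smul_mul_assoc, tm_mul_tm a (lamD_mem hx) hb y]
      simp only [add_tm, tm_add, smul_tm, tm_smul, smul_add, smul_smul]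
      rcases neg_one_pow_eq_or k j with hj | hj <;> rcases neg_one_pow_eq_or k i with hi | hi <;>
      rcases neg_one_pow_eq_or k (i * j) with hij | hij <;>
      simp only [pow_add, add_mul, mul_add, mul_one, one_mul, pow_one, hi, hj, hij] <;> module
  | zero_left y hy => simp
  | zero_right x hx => simp
  | add_left x y z _ _ _ h1 h2 => simp only [add_mul, map_add, h1, h2]; abel
  | add_right x y z _ _ _ h1 h2 => simp only [mul_add, map_add, h1, h2]; abel
  | smul_left r x y _ _ h => simp only [smul_mul_assoc, map_smul, h, smul_add]
  | smul_right r x y _ _ h => simp only [mul_smul_comm, map_smul, h, smul_add]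

variable (C n)

/-- `Kⁿ(C) = Z⁰(C ⊗ Λⁿ)`: the cocycles of total degree zero, as a subalgebra of `C ⊗ Λⁿ`. -/
def kSubalgebra : Subalgebra k (TensorLam C n) where
  carrier := {t | t ∈ tensorZero C n ∧ tensorD C n t = 0}
  mul_mem' hs ht := ⟨tensorZero_mul hs.1 ht.1, by rw [tensorD_mul hs.1 ht.1, hs.2, ht.2]; simp⟩
  add_mem' hs ht := ⟨add_mem hs.1 ht.1, by rw [map_add, hs.2, ht.2, add_zero]⟩
  algebraMap_mem' r := by
    rw [Algebra.algebraMap_eq_smul_one]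
    refine ⟨Submodule.smul_mem _ _ tensorZero_one, ?_⟩
    have h := tensorD_mul (C := C) (n := n) tensorZero_one tensorZero_one
    rw [mul_one, mul_one, one_mul] at h
    rw [map_smul, left_eq_add.mp h, smul_zero]

instance : CommRing (kSubalgebra C n) where
  mul_comm s t := Subtype.ext (tensorZero_comm s.2.1 t.2.1)

variable {C n}

/-- The linear map `f ⊗ α : C ⊗ Λᵐ → D ⊗ Λⁿ`. -/
def tensorMap {C D : CDGA k} (f : C ⟶ D) {m n : SimplexCategory} (α : m ⟶ n) :
    TensorLam C m →ₗ[k] TensorLam D n :=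
  (GradedTensorProduct.of k D.deg (lamDeg k n)).toLinearMap ∘ₗ
    TensorProduct.map (CDGA.Hom.toAlgHom f).toLinearMap (lamMap k α).toLinearMap ∘ₗ
      (GradedTensorProduct.of k C.deg (lamDeg k m)).symm.toLinearMap

section Map

variable {C D : CDGA k} (f : C ⟶ D) {m n : SimplexCategory} (α : m ⟶ n)

lemma tensorMap_tm (a : C.carrier) (x : Lam k m) :
    tensorMap f α (tm C m a x) = tm D n (CDGA.Hom.toAlgHom f a) (lamMap k α x) := rfl

lemma tensorMap_mem {t : TensorLam C m} (ht : t ∈ tensorZero C m) :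
    tensorMap f α t ∈ tensorZero D n := by
  induction ht using Submodule.span_induction with
  | mem t ht =>
    obtain ⟨i, a, x, ha, hx, rfl⟩ := ht
    exact Submodule.subset_span ⟨i, _, _, f.map_deg i a ha, lamMap_mem α hx, rfl⟩
  | zero => simp
  | add x y _ _ h1 h2 => rw [map_add]; exact add_mem h1 h2
  | smul r x _ h => rw [map_smul]; exact Submodule.smul_mem _ _ h

lemma tensorMap_tensorD {t : TensorLam C m} (ht : t ∈ tensorZero C m) :
    tensorMap f α (tensorD C m t) = tensorD D n (tensorMap f α t) := by
  induction ht using Submodule.span_induction with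
  | mem t ht =>
    obtain ⟨i, a, x, ha, hx, rfl⟩ := ht
    rw [tensorMap_tm, tensorD_tm ha, tensorD_tm (f.map_deg i a ha), map_add, map_smul,
      tensorMap_tm, tensorMap_tm, f.map_d, lamMap_lamD]
  | zero => simp
  | add x y _ _ h1 h2 => simp only [map_add, h1, h2]
  | smul r x _ h => simp only [map_smul, h]

lemma tensorMap_mul {s t : TensorLam C m} (hs : s ∈ tensorZero C m) (ht : t ∈ tensorZero C m) :
    tensorMap f α (s * t) = tensorMap f α s * tensorMap f α t := by
  induction hs, ht using Submodule.span_induction₂ with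
  | mem_mem s t hs ht =>
    obtain ⟨i, a, x, ha, hx, rfl⟩ := hs
    obtain ⟨j, b, y, hb, hy, rfl⟩ := ht
    rw [tm_mul_tm a hx hb y, map_smul, tensorMap_tm, tensorMap_tm, tensorMap_tm,
      tm_mul_tm _ (lamMap_mem α hx) (f.map_deg j b hb), map_mul, map_mul]
  | zero_left y hy => simp
  | zero_right x hx => simp
  | add_left x y z _ _ _ h1 h2 => simp only [add_mul, map_add, h1, h2]
  | add_right x y z _ _ _ h1 h2 => simp only [mul_add, map_add, h1, h2]
  | smul_left r x y _ _ h => simp only [smul_mul_assoc, map_smul, h]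
  | smul_right r x y _ _ h => simp only [mul_smul_comm, map_smul, h]

lemma tensorMap_one : tensorMap f α (1 : TensorLam C m) = 1 := by
  change tensorMap f α (tm C m 1 1) = 1
  rw [tensorMap_tm, map_one, map_one]
  rfl

/-- The algebra morphism `Kᵐ(C) → Kⁿ(D)` induced by a morphism of cdgas and a map `[m] → [n]`. -/
def kMap : kSubalgebra C m →ₐ[k] kSubalgebra D n :=
  AlgHom.ofLinearMap
    ((tensorMap f α).restrict (p := Subalgebra.toSubmodule (kSubalgebra C m))
      (q := Subalgebra.toSubmodule (kSubalgebra D n))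
      fun t ht => ⟨tensorMap_mem f α ht.1, by rw [← tensorMap_tensorD f α ht.1, ht.2, map_zero]⟩)
    (Subtype.ext (tensorMap_one f α))
    fun s t => Subtype.ext (tensorMap_mul f α s.2.1 t.2.1)

lemma kMap_coe (t : kSubalgebra C m) : (kMap f α t : TensorLam D n) = tensorMap f α t := rfl

end Map

lemma tensorMap_id {C : CDGA k} {n : SimplexCategory} (t : TensorLam C n) :
    tensorMap (𝟙 C) (𝟙 n) t = t := by
  have h : (lamMap k (𝟙 n)).toLinearMap = LinearMap.id := LinearMap.ext lamMap_id
  have h' : (CDGA.Hom.toAlgHom (𝟙 C)).toLinearMap = LinearMap.id := rfl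
  rw [tensorMap, h, h', TensorProduct.map_id]
  rfl

lemma tensorMap_comp {C D E : CDGA k} (f : C ⟶ D) (g : D ⟶ E) {l m n : SimplexCategory}
    (α : l ⟶ m) (β : m ⟶ n) (t : TensorLam C l) :
    tensorMap (f ≫ g) (α ≫ β) t = tensorMap g β (tensorMap f α t) := by
  have h : (lamMap k (α ≫ β)).toLinearMap = (lamMap k β).toLinearMap ∘ₗ (lamMap k α).toLinearMap :=
    LinearMap.ext (lamMap_comp α β)
  have h' : (CDGA.Hom.toAlgHom (f ≫ g)).toLinearMap =
      (CDGA.Hom.toAlgHom g).toLinearMap ∘ₗ (CDGA.Hom.toAlgHom f).toLinearMap := rfl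
  rw [tensorMap, h, h', TensorProduct.map_comp]
  rfl

end K

/-- Cosimplicial commutative `k`-algebras. -/
abbrev CosimpAlg (k : Type u) [Field k] : Type (u + 1) := SimplexCategory ⥤ CommAlgCat.{u} k

/-- The functor `K_alg` from cdgas to cosimplicial commutative algebras, `Kⁿ(C) = Z⁰(C ⊗ Λⁿ)`. -/
def Kalg (k : Type u) [Field k] : CDGA k ⥤ CosimpAlg k where
  obj C :=
    { obj := fun n => CommAlgCat.of k (kSubalgebra C n)
      map := fun α => CommAlgCat.ofHom (kMap (𝟙 C) α)
      map_id := fun n => by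
        ext t
        exact tensorMap_id _
      map_comp := fun α β => by
        ext t
        have := tensorMap_comp (𝟙 C) (𝟙 C) α β (t : TensorLam C _)
        rw [Category.comp_id] at this
        exact this }
  map f :=
    { app := fun n => CommAlgCat.ofHom (kMap f (𝟙 n))
      naturality := fun m n α => by
        ext t
        have h1 := tensorMap_comp (𝟙 _) f α (𝟙 n) (t : TensorLam _ _)
        have h2 := tensorMap_comp f (𝟙 _) (𝟙 m) α (t : TensorLam _ _)
        rw [Category.comp_id, Category.id_comp] at h1 h2
        exact h1.symm.trans h2 }
  map_id C := by
    ext n t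
    exact tensorMap_id _
  map_comp f g := by
    ext n t
    have := tensorMap_comp f g (𝟙 n) (𝟙 n) (t : TensorLam _ n)
    rw [Category.comp_id] at this
    exact this

/-! ### Completion -/

section Completion

/-- The ideal `𝔪ⁿ ⊆ Aⁿ`: the kernel of the map `Aⁿ → A⁰` induced by the unique map `[n] → [0]`.
If `A⁰ = k` this is the augmentation ideal of `Aⁿ`. -/
def augIdeal (A : CosimpAlg k) (n : SimplexCategory) : Ideal (A.obj n) :=
  RingHom.ker (A.map (SimplexCategory.isTerminalZero.from n)).hom

lemma augIdeal_map (A : CosimpAlg k) {m n : SimplexCategory} (α : m ⟶ n) :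
    augIdeal A m ≤ (augIdeal A n).comap (A.map α).hom := by
  intro x hx
  change (A.map (SimplexCategory.isTerminalZero.from n)).hom ((A.map α).hom x) = 0
  rw [← AlgHom.comp_apply, ← CommAlgCat.hom_comp, ← A.map_comp,
    SimplexCategory.isTerminalZero.hom_ext (α ≫ _) (SimplexCategory.isTerminalZero.from m)]
  exact hx

lemma augIdeal_app {A B : CosimpAlg k} (f : A ⟶ B) (n : SimplexCategory) :
    augIdeal A n ≤ (augIdeal B n).comap (f.app n).hom := by
  intro x hx
  change (B.map (SimplexCategory.isTerminalZero.from n)).hom ((f.app n).hom x) = 0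
  rw [← AlgHom.comp_apply, ← CommAlgCat.hom_comp, ← f.naturality, CommAlgCat.hom_comp,
    AlgHom.comp_apply]
  have hx' : (A.map (SimplexCategory.isTerminalZero.from n)).hom x = 0 := hx
  rw [hx', map_zero]

lemma completionMap_compat {R S : Type u} [CommRing R] [CommRing S] [Algebra k R] [Algebra k S]
    (I : Ideal R) (J : Ideal S) (f : R →ₐ[k] S) (h : I ≤ J.comap f) {a b : ℕ} (hab : a ≤ b) :
    (Ideal.Quotient.factorₐ k (Ideal.pow_le_pow_right hab)).comp
      ((Ideal.quotientMapₐ (J ^ b) f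
        ((Ideal.pow_right_mono h b).trans (Ideal.le_comap_pow f b))).comp
          ((AdicCompletion.evalₐ I b).restrictScalars k)) =
      (Ideal.quotientMapₐ (J ^ a) f
        ((Ideal.pow_right_mono h a).trans (Ideal.le_comap_pow f a))).comp
          ((AdicCompletion.evalₐ I a).restrictScalars k) := by
  ext x
  obtain ⟨c, rfl⟩ := AdicCompletion.mk_surjective I R x
  simp only [AlgHom.comp_apply, AlgHom.restrictScalars_apply, AdicCompletion.evalₐ_mk,
    Ideal.quotient_map_mkₐ]
  change Ideal.Quotient.mk (J ^ a) (f (c.val b)) = Ideal.Quotient.mk (J ^ a) (f (c.val a))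
  have hc := AdicCompletion.Ideal.mk_eq_mk I hab c
  rw [Ideal.Quotient.eq] at hc ⊢
  rw [← map_sub]
  exact ((Ideal.pow_right_mono h a).trans (Ideal.le_comap_pow f a)) hc

/-- The map induced on adic completions by an algebra morphism mapping `I` into `J`. -/
def completionMap {R S : Type u} [CommRing R] [CommRing S] [Algebra k R] [Algebra k S]
    (I : Ideal R) (J : Ideal S) (f : R →ₐ[k] S) (h : I ≤ J.comap f) :
    AdicCompletion I R →ₐ[k] AdicCompletion J S :=
  AdicCompletion.liftAlgHom J
    (fun i => (Ideal.quotientMapₐ (J ^ i) f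
      ((Ideal.pow_right_mono h i).trans (Ideal.le_comap_pow f i))).comp
        ((AdicCompletion.evalₐ I i).restrictScalars k))
    (completionMap_compat I J f h)

section

variable {R S T : Type u} [CommRing R] [CommRing S] [CommRing T] [Algebra k R] [Algebra k S]
  [Algebra k T] {I : Ideal R} {J : Ideal S} {L : Ideal T}

lemma eval_completionMap (f : R →ₐ[k] S) (h : I ≤ J.comap f) (i : ℕ)
    (c : AdicCompletion.AdicCauchySequence I R) :
    AdicCompletion.evalₐ J i (completionMap I J f h (AdicCompletion.mk I R c)) =
      Ideal.Quotient.mk (J ^ i) (f (c.val i)) := by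
  refine (AdicCompletion.evalₐ_liftAlgHom J _ (completionMap_compat I J f h) i _).trans ?_
  rw [AlgHom.comp_apply, AlgHom.restrictScalars_apply, AdicCompletion.evalₐ_mk]
  rfl

lemma eval_completionMap' (f : R →ₐ[k] S) (h : I ≤ J.comap f) (i : ℕ) (x : AdicCompletion I R) :
    AdicCompletion.evalₐ J i (completionMap I J f h x) =
      Ideal.quotientMapₐ (J ^ i) f ((Ideal.pow_right_mono h i).trans (Ideal.le_comap_pow f i))
        (AdicCompletion.evalₐ I i x) := by
  exact AdicCompletion.evalₐ_liftAlgHom J _ (completionMap_compat I J f h) i _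

lemma completionMap_id (h : I ≤ I.comap (AlgHom.id k R)) (x : AdicCompletion I R) :
    completionMap I I (AlgHom.id k R) h x = x := by
  refine AdicCompletion.ext_evalₐ fun i => ?_
  obtain ⟨c, rfl⟩ := AdicCompletion.mk_surjective I R x
  rw [eval_completionMap, AdicCompletion.evalₐ_mk]
  rfl

lemma completionMap_comp (f : R →ₐ[k] S) (g : S →ₐ[k] T) (hf : I ≤ J.comap f) (hg : J ≤ L.comap g)
    (hgf : I ≤ L.comap (g.comp f)) (x : AdicCompletion I R) :
    completionMap I L (g.comp f) hgf x = completionMap J L g hg (completionMap I J f hf x) := by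
  refine AdicCompletion.ext_evalₐ fun i => ?_
  obtain ⟨c, rfl⟩ := AdicCompletion.mk_surjective I R x
  rw [eval_completionMap, eval_completionMap', eval_completionMap]
  rfl

lemma completionMap_of (f : R →ₐ[k] S) (h : I ≤ J.comap f) (x : R) :
    completionMap I J f h (algebraMap R (AdicCompletion I R) x) =
      algebraMap S (AdicCompletion J S) (f x) := by
  refine AdicCompletion.ext_evalₐ fun i => ?_
  rw [eval_completionMap', AlgHom.commutes, AlgHom.commutes]
  rfl

end

/-- The functor sending `A` to its completion `Â`, with `Âⁿ = lim_i Aⁿ / (𝔪ⁿ)^i`. -/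
def completion (k : Type u) [Field k] : CosimpAlg k ⥤ CosimpAlg k where
  obj A :=
    { obj := fun n => CommAlgCat.of k (AdicCompletion (augIdeal A n) (A.obj n))
      map := fun {m n} α => CommAlgCat.ofHom (completionMap _ _ (A.map α).hom (augIdeal_map A α))
      map_id := fun n => by
        refine CommAlgCat.hom_ext (AlgHom.ext fun x => ?_)
        have := completionMap_id (augIdeal_map A (𝟙 n) |>.trans (by rw [A.map_id]; rfl)) x
        refine Eq.trans ?_ this
        simp
      map_comp := fun {l m n} α β => by
        refine CommAlgCat.hom_ext (AlgHom.ext fun x => ?_)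
        have := completionMap_comp (A.map α).hom (A.map β).hom (augIdeal_map A α)
          (augIdeal_map A β) ((augIdeal_map A (α ≫ β)).trans (by rw [A.map_comp]; rfl)) x
        refine Eq.trans ?_ this
        simp }
  map {A B} f :=
    { app := fun n => CommAlgCat.ofHom (completionMap _ _ (f.app n).hom (augIdeal_app f n))
      naturality := fun m n α => by
        refine CommAlgCat.hom_ext (AlgHom.ext fun x => ?_)
        have h : (augIdeal A m) ≤ (augIdeal B n).comap (A.map α ≫ f.app n).hom :=
          (augIdeal_map A α).trans (Ideal.comap_mono (augIdeal_app f n))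
        have h1 := completionMap_comp (A.map α).hom (f.app n).hom (augIdeal_map A α)
          (augIdeal_app f n) h x
        have h2 := completionMap_comp (f.app m).hom (B.map α).hom (augIdeal_app f m)
          (augIdeal_map B α) (by rw [← CommAlgCat.hom_comp, ← f.naturality]; exact h) x
        refine h1.symm.trans (Eq.trans ?_ h2)
        simp only [← CommAlgCat.hom_comp, f.naturality] }
  map_id A := by
    refine NatTrans.ext (funext fun n => CommAlgCat.hom_ext (AlgHom.ext fun x => ?_))
    exact completionMap_id (augIdeal_app (𝟙 A) n) x
  map_comp {A B C} f g := by
    refine NatTrans.ext (funext fun n => CommAlgCat.hom_ext (AlgHom.ext fun x => ?_))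
    exact completionMap_comp (f.app n).hom (g.app n).hom (augIdeal_app f n) (augIdeal_app g n)
      (augIdeal_app (f ≫ g) n) x

/-- The canonical natural morphism `A ⟶ Â`. -/
def toCompletion (k : Type u) [Field k] : 𝟭 (CosimpAlg k) ⟶ completion k where
  app A :=
    { app := fun n => CommAlgCat.ofHom
        (IsScalarTower.toAlgHom k (A.obj n) (AdicCompletion (augIdeal A n) (A.obj n)))
      naturality := fun m n α => by
        ext x
        exact (completionMap_of (A.map α).hom (augIdeal_map A α) x).symm }
  naturality A B f := by
    ext n x
    exact (completionMap_of (f.app n).hom (augIdeal_app f n) x).symm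

end Completion

/-! ### Reduced and finitely generated objects -/

section Properties

/-- A cosimplicial algebra is reduced if `A⁰ = k`. -/
def CosimpAlg.IsReduced (A : CosimpAlg k) : Prop :=
  Function.Bijective (algebraMap k (A.obj (SimplexCategory.mk 0)))

/-- Reduced cosimplicial algebras such that each `Aⁿ` is a finitely generated `k`-algebra. -/
def reducedFG (k : Type u) [Field k] : ObjectProperty (CosimpAlg k) := fun A =>
  A.IsReduced ∧ ∀ n, Algebra.FiniteType k (A.obj n)

/-- Reduced cosimplicial algebras such that each augmentation ideal `𝔪ⁿ ⊆ Aⁿ` is finitely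
generated. -/
def reducedFGIdeal (k : Type u) [Field k] : ObjectProperty (CosimpAlg k) := fun A =>
  A.IsReduced ∧ ∀ n, (augIdeal A n).FG

/-- A complete local Noetherian `k`-algebra with residue field `k`. -/
structure IsCompleteLocalNoetherian (k : Type u) [Field k] (R : Type u) [CommRing R]
    [Algebra k R] : Prop where
  isLocalRing : IsLocalRing R
  isNoetherianRing : IsNoetherianRing R
  isAdicComplete : IsAdicComplete (IsLocalRing.maximalIdeal R) R
  bijective : Function.Bijective (algebraMap k (IsLocalRing.ResidueField R))

/-- Reduced cosimplicial objects in the category of complete local Noetherian `k`-algebras with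
residue field `k`. Every `k`-algebra morphism between such algebras is local, so that they form a
full subcategory of the cosimplicial algebras. -/
def reducedComplete (k : Type u) [Field k] : ObjectProperty (CosimpAlg k) := fun A =>
  A.IsReduced ∧ ∀ n, IsCompleteLocalNoetherian k (A.obj n)

/-- A cdga is reduced if `C⁰ = k`. -/
def CDGA.IsReduced (C : CDGA k) : Prop :=
  Function.Injective (algebraMap k C.carrier) ∧
    ∀ x ∈ C.deg 0, ∃ r : k, algebraMap k C.carrier r = x

/-- Reduced cdgas that are finite-dimensional in each positive degree. -/
def reducedFGCDGA (k : Type u) [Field k] : ObjectProperty (CDGA k) := fun C =>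
  C.IsReduced ∧ ∀ i : ℕ, 1 ≤ i → FiniteDimensional k (C.deg i)

/-- The restriction of a functor to full subcategories. -/
abbrev restrict {X Y : Type*} [Category X] [Category Y] {P : ObjectProperty X}
    {Q : ObjectProperty Y} (F : X ⥤ Y) (hF : ∀ A, P A → Q (F.obj A)) :
    P.FullSubcategory ⥤ Q.FullSubcategory :=
  Q.lift (P.ι ⋙ F) fun A => hF A.obj A.property

end Properties

end CosimplicialDK

end

open CosimplicialDK

/-!
An element of `C ⊗ Λⁿ` is determined by its coefficients in `C`, which iterated contractions on `Λⁿ`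
read off. For a morphism `A ⟶ K(C)`, the coefficients of the images of elements of the `Aⁿ` span a
subalgebra of `C`, because a product of coefficients is a coefficient of a product over the join of
two simplices, and this subalgebra is closed under `d`, because `d` of a coefficient is again a
coefficient up to sign. Hence the coefficients in all cdgas under `A` at once span `D(A)`. Every
coefficient of degree `p` arises from a single list of functionals on `Λ²ᵖ`, so that `D(A)ᵖ` is a
quotient of `A²ᵖ`.

The `j`-th power of the augmentation ideal of `Kⁿ(C)` has no coefficients of degree less than `j`.
Therefore `D(A)ᵖ` is even a quotient of `A²ᵖ / 𝔪ᵖ⁺¹`, which is finite-dimensional when `𝔪` is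
finitely generated, and the augmentation ideals of `K(C)` are nilpotent, so that `A ⟶ Â` induces
bijections on morphisms to `K(C)` and `D(A) ⟶ D(Â)` is an isomorphism.
-/

noncomputable section

namespace CosimplicialDK

variable {k : Type u} [Field k]

/-! ### Contractions on exterior algebras -/

section Contraction

open ExteriorAlgebra

variable {R M N P : Type*} [CommRing R] [AddCommGroup M] [Module R M] [AddCommGroup N] [Module R N]
  [AddCommGroup P] [Module R P]

/-- The contraction (interior product) with a linear functional. For the functional that is `1` on
the generators it is the differential of `Λⁿ`. -/
def contract (f : Module.Dual R M) : ExteriorAlgebra R M →ₗ[R] ExteriorAlgebra R M :=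
  CliffordAlgebra.contractLeft (Q := 0) f

lemma contract_algebraMap (f : Module.Dual R M) (r : R) :
    contract f (algebraMap R (ExteriorAlgebra R M) r) = 0 :=
  CliffordAlgebra.contractLeft_algebraMap (Q := 0) f r

lemma contract_ι_mul (f : Module.Dual R M) (v : M) (x : ExteriorAlgebra R M) :
    contract f (ι R v * x) = f v • x - ι R v * contract f x :=
  CliffordAlgebra.contractLeft_ι_mul (Q := 0) (d := f) v x

lemma contract_zero : contract (0 : Module.Dual R M) = 0 :=
  map_zero (CliffordAlgebra.contractLeft (Q := 0))

lemma contract_comm (f g : Module.Dual R M) (x : ExteriorAlgebra R M) :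
    contract f (contract g x) = -contract g (contract f x) :=
  CliffordAlgebra.contractLeft_comm (Q := 0) f g x

lemma exteriorAlgebra_left_induction {p : ExteriorAlgebra R M → Prop}
    (algebraMap : ∀ r, p (algebraMap R _ r)) (add : ∀ x y, p x → p y → p (x + y))
    (ι_mul : ∀ v x, p x → p (ι R v * x)) (x : ExteriorAlgebra R M) : p x :=
  CliffordAlgebra.left_induction (P := p) 0 algebraMap add (fun x v => ι_mul v x) x

lemma involute_ι_mul (v : M) (x : ExteriorAlgebra R M) :
    CliffordAlgebra.involute (ι R v * x) = -(ι R v * CliffordAlgebra.involute x) := by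
  rw [map_mul, ← neg_mul]
  exact congrArg (· * _) (CliffordAlgebra.involute_ι (Q := (0 : QuadraticForm R M)) v)

lemma contract_mul (f : Module.Dual R M) (x y : ExteriorAlgebra R M) :
    contract f (x * y) = contract f x * y + CliffordAlgebra.involute x * contract f y := by
  induction x using exteriorAlgebra_left_induction with
  | algebraMap r =>
    simp only [← Algebra.smul_def, map_smul, contract_algebraMap, AlgHom.commutes, zero_mul,
      zero_add]
  | add x x' hx hx' => simp only [add_mul, map_add, hx, hx']; abel
  | ι_mul v x hx =>
    rw [mul_assoc, contract_ι_mul, hx, contract_ι_mul, involute_ι_mul]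
    simp only [mul_add, sub_mul, smul_mul_assoc, neg_mul, mul_assoc]
    abel

lemma contract_map (f : Module.Dual R N) (g : M →ₗ[R] N) (x : ExteriorAlgebra R M) :
    contract f (map g x) = map g (contract (f ∘ₗ g) x) := by
  induction x using exteriorAlgebra_left_induction with
  | algebraMap r => rw [AlgHom.commutes, contract_algebraMap, contract_algebraMap, map_zero]
  | add x y hx hy => simp only [map_add, hx, hy]
  | ι_mul v x hx =>
    simp only [map_mul, map_apply_ι, contract_ι_mul, hx, map_sub, map_smul, LinearMap.comp_apply]

lemma involute_map (g : M →ₗ[R] N) (x : ExteriorAlgebra R M) :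
    CliffordAlgebra.involute (map g x) = map g (CliffordAlgebra.involute x) := by
  induction x using exteriorAlgebra_left_induction with
  | algebraMap r => simp only [AlgHom.commutes]
  | add x y hx hy => simp only [map_add, hx, hy]
  | ι_mul v x hx =>
    rw [map_mul, map_apply_ι, involute_ι_mul, hx, involute_ι_mul, map_neg, map_mul, map_apply_ι]

lemma algebraMapInv_ι_mul (v : M) (x : ExteriorAlgebra R M) :
    algebraMapInv (R := R) (ι R v * x) = 0 := by
  simp [algebraMapInv]

lemma algebraMapInv_map (g : M →ₗ[R] N) (x : ExteriorAlgebra R M) :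
    algebraMapInv (map g x) = algebraMapInv (R := R) x := by
  induction x using exteriorAlgebra_left_induction with
  | algebraMap r => simp only [AlgHom.commutes]
  | add x y hx hy => simp only [map_add, hx, hy]
  | ι_mul v x => rw [map_mul, map_apply_ι, algebraMapInv_ι_mul, algebraMapInv_ι_mul]

lemma algebraMapInv_involute (x : ExteriorAlgebra R M) :
    algebraMapInv (R := R) (CliffordAlgebra.involute x) = algebraMapInv (R := R) x := by
  induction x using exteriorAlgebra_left_induction with
  | algebraMap r => simp only [AlgHom.commutes]
  | add x y hx hy => simp only [map_add, hx, hy]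
  | ι_mul v x =>
    rw [involute_ι_mul, map_neg, algebraMapInv_ι_mul, algebraMapInv_ι_mul, neg_zero]

lemma contract_of_mem_zero (f : Module.Dual R M) {x : ExteriorAlgebra R M} (hx : x ∈ ⋀[R]^0 M) :
    contract f x = 0 := by
  rw [exteriorPower, pow_zero] at hx
  obtain ⟨r, rfl⟩ := Submodule.mem_one.mp hx
  exact contract_algebraMap f r

lemma contract_mem (f : Module.Dual R M) {i : ℕ} {x : ExteriorAlgebra R M}
    (hx : x ∈ ⋀[R]^(i + 1) M) : contract f x ∈ ⋀[R]^i M := by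
  induction i generalizing x with
  | zero =>
    rw [exteriorPower, pow_one] at hx
    obtain ⟨v, rfl⟩ := hx
    rw [← mul_one (ι R v), contract_ι_mul, ← map_one (algebraMap R _), contract_algebraMap,
      mul_zero, sub_zero]
    exact Submodule.smul_mem _ _ (SetLike.algebraMap_mem_graded (fun i => ⋀[R]^i M) 1)
  | succ i ih =>
    rw [exteriorPower, pow_succ'] at hx
    induction hx using Submodule.mul_induction_on' with
    | mem_mul_mem _ hv y hy =>
      obtain ⟨v, rfl⟩ := hv
      rw [contract_ι_mul]
      refine sub_mem (Submodule.smul_mem _ _ hy) ?_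
      rw [exteriorPower, pow_succ']
      exact Submodule.mul_mem_mul ⟨v, rfl⟩ (ih hy)
    | add x _ y _ hx hy => rw [map_add]; exact add_mem hx hy

lemma algebraMapInv_of_mem {i : ℕ} (hi : i ≠ 0) {x : ExteriorAlgebra R M} (hx : x ∈ ⋀[R]^i M) :
    algebraMapInv (R := R) x = 0 := by
  obtain ⟨i, rfl⟩ := Nat.exists_eq_succ_of_ne_zero hi
  rw [exteriorPower, pow_succ'] at hx
  induction hx using Submodule.mul_induction_on' with
  | mem_mul_mem _ hv y _ =>
    obtain ⟨v, rfl⟩ := hv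
    exact algebraMapInv_ι_mul v y
  | add x _ y _ hx hy => rw [map_add, hx, hy, add_zero]

/-- The functional on the exterior algebra which contracts successively with the members of a list,
starting from its head, and then takes the scalar part. -/
def contractList : List (Module.Dual R M) → ExteriorAlgebra R M →ₗ[R] R
  | [] => algebraMapInv.toLinearMap
  | f :: fs => contractList fs ∘ₗ contract f

lemma contractList_nil (x : ExteriorAlgebra R M) :
    contractList [] x = algebraMapInv (R := R) x := rfl

lemma contractList_cons (f : Module.Dual R M) (fs : List (Module.Dual R M))
    (x : ExteriorAlgebra R M) : contractList (f :: fs) x = contractList fs (contract f x) := rfl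

lemma contractList_map (fs : List (Module.Dual R N)) (g : M →ₗ[R] N) (x : ExteriorAlgebra R M) :
    contractList fs (map g x) = contractList (fs.map (· ∘ₗ g)) x := by
  induction fs generalizing x with
  | nil => exact algebraMapInv_map g x
  | cons f fs ih => rw [contractList_cons, contract_map, ih]; rfl

lemma contractList_of_mem (fs : List (Module.Dual R M)) {i : ℕ} {x : ExteriorAlgebra R M}
    (hx : x ∈ ⋀[R]^i M) (hi : i ≠ fs.length) : contractList fs x = 0 := by
  induction fs generalizing i x with
  | nil => exact algebraMapInv_of_mem hi hx
  | cons f fs ih =>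
    cases i with
    | zero => rw [contractList_cons, contract_of_mem_zero f hx, map_zero]
    | succ i => exact ih (contract_mem f hx) fun h => hi (congrArg (· + 1) h)

lemma contractList_eq_zero {f : Module.Dual R M} {fs : List (Module.Dual R M)} (hf : f ∈ fs)
    {x : ExteriorAlgebra R M} (hx : contract f x = 0) : contractList fs x = 0 := by
  induction fs generalizing x with
  | nil => simp at hf
  | cons g fs ih =>
    obtain rfl | hf := List.mem_cons.mp hf
    · rw [contractList_cons, hx, map_zero]
    · exact ih hf (by rw [contract_comm, hx, map_zero, neg_zero])

lemma contractList_append_map_mul_map {i : M →ₗ[R] P} {j : N →ₗ[R] P}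
    {fs gs : List (Module.Dual R P)} (hf : ∀ f ∈ fs, f ∘ₗ j = 0) (hg : ∀ g ∈ gs, g ∘ₗ i = 0)
    (x : ExteriorAlgebra R M) (y : ExteriorAlgebra R N) :
    contractList (fs ++ gs) (map i x * map j y) =
      contractList (fs.map (· ∘ₗ i)) x * contractList (gs.map (· ∘ₗ j)) y := by
  induction fs generalizing x with
  | nil =>
    induction gs generalizing x y with
    | nil =>
      rw [List.append_nil, contractList_nil, map_mul, algebraMapInv_map, algebraMapInv_map]; rfl
    | cons g gs ih =>
      rw [List.nil_append, contractList_cons, contract_mul, contract_map,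
        hg g List.mem_cons_self, contract_zero, LinearMap.zero_apply, map_zero, zero_mul, zero_add,
        involute_map, contract_map, ← List.nil_append gs,
        ih (fun g' h => hg g' (List.mem_cons_of_mem g h))]
      exact congrArg (· * _) (algebraMapInv_involute x)
  | cons f fs ih =>
    rw [List.cons_append, contractList_cons, contract_mul, contract_map, contract_map f j,
      hf f List.mem_cons_self, contract_zero, LinearMap.zero_apply, map_zero, mul_zero, add_zero,
      ih fun f' h => hf f' (List.mem_cons_of_mem f h)]
    rfl

lemma contract_prod_ι {f : Module.Dual R M} {vs : List M} (h : ∀ v ∈ vs, f v = 0) :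
    contract f (vs.map (ι R)).prod = 0 := by
  induction vs with
  | nil => simpa using contract_algebraMap f 1
  | cons v vs ih =>
    rw [List.map_cons, List.prod_cons, contract_ι_mul, h v List.mem_cons_self, zero_smul,
      ih fun w hw => h w (List.mem_cons_of_mem v hw), mul_zero, sub_zero]

end Contraction

section Basis

open ExteriorAlgebra Module

variable {R M I : Type*} [CommRing R] [AddCommGroup M] [Module R M] [LinearOrder I]
  (b : Basis I R M)

/-- The coordinate functionals indexed by `S`, in increasing order. -/
def coordList (S : Finset I) : List (Dual R M) := S.sort.map b.coord

lemma length_coordList (S : Finset I) : (coordList b S).length = S.card := by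
  rw [coordList, List.length_map, Finset.length_sort]

lemma contractList_map_coord_prod {l : List I} (hl : l.Nodup) :
    contractList (l.map b.coord) ((l.map b).map (ι R)).prod = 1 := by
  induction l with
  | nil => exact map_one (algebraMapInv : ExteriorAlgebra R M →ₐ[R] R)
  | cons i l ih =>
    have hil : ∀ v ∈ l.map b, b.coord i v = 0 := by
      rintro _ hv
      obtain ⟨j, hj, rfl⟩ := List.mem_map.mp hv
      rw [Basis.coord_apply, Basis.repr_self_apply, if_neg]
      rintro rfl
      exact hl.notMem hj
    rw [List.map_cons, List.map_cons, List.map_cons, List.prod_cons, contractList_cons,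
      contract_ι_mul, contract_prod_ι hil, mul_zero, sub_zero, Basis.coord_apply,
      Basis.repr_self_apply, if_pos rfl, one_smul, ih hl.of_cons]

lemma basis_exteriorAlgebra_eq_prod (S : Finset I) :
    b.ExteriorAlgebra S = ((S.sort.map b).map (ι R)).prod := by
  rw [ExteriorAlgebra.basis_apply_ofCard b rfl]
  refine (ιMulti_apply _).trans ?_
  congr 1
  refine List.ext_getElem (by simp) fun i _ _ => ?_
  simp [Set.powersetCard.ofFinEmbEquiv_symm_apply, Finset.orderEmbOfFin_apply]

lemma basis_exteriorAlgebra_mem (S : Finset I) :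
    b.ExteriorAlgebra S ∈ ⋀[R]^S.card M := by
  rw [ExteriorAlgebra.basis_apply_ofCard b rfl]
  exact ιMulti_range R _ ⟨_, rfl⟩

lemma contractList_coordList (S : Finset I) :
    contractList (coordList b S) = b.ExteriorAlgebra.coord S := by
  refine b.ExteriorAlgebra.ext fun T => ?_
  rw [Basis.coord_apply, Basis.repr_self_apply]
  split_ifs with h
  · rw [h, basis_exteriorAlgebra_eq_prod]
    exact contractList_map_coord_prod b (S.sort_nodup _)
  · by_cases hST : S ⊆ T
    · refine contractList_of_mem _ (basis_exteriorAlgebra_mem b T) fun hc => h ?_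
      rw [length_coordList] at hc
      exact (Finset.eq_of_subset_of_card_le hST hc.le).symm
    · obtain ⟨i, hiS, hiT⟩ := Finset.not_subset.mp hST
      refine contractList_eq_zero (f := b.coord i) (List.mem_map_of_mem ((S.mem_sort _).mpr hiS)) ?_
      rw [basis_exteriorAlgebra_eq_prod]
      refine contract_prod_ι fun v hv => ?_
      obtain ⟨j, hj, rfl⟩ := List.mem_map.mp hv
      rw [Basis.coord_apply, Basis.repr_self_apply, if_neg]
      rintro rfl
      exact hiT ((T.mem_sort _).mp hj)

end Basis

/-! ### Coefficients of elements of `C ⊗ Λⁿ` -/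

section Coefficients

variable (k) in
/-- Linear functionals on the span of the generators of `Λⁿ`. -/
abbrev LamDual (n : SimplexCategory) : Type u := Module.Dual k (Fin (n.len + 1) →₀ k)

variable {C D : CDGA k} {m n : SimplexCategory}

/-- The pullback of a functional along the linear map that underlies `Λᵐ → Λⁿ`. -/
abbrev pullback (α : m ⟶ n) (f : LamDual k n) : LamDual k m :=
  f ∘ₗ Finsupp.lmapDomain k k α.toOrderHom

/-- The coefficient map `C ⊗ Λⁿ → C`, `a ⊗ x ↦ ⟨fs, x⟩ a`, of a list of functionals. -/
def coeff (fs : List (LamDual k n)) : TensorLam C n →ₗ[k] C.carrier :=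
  (TensorProduct.rid k C.carrier).toLinearMap ∘ₗ
    TensorProduct.map LinearMap.id (contractList fs) ∘ₗ
      (GradedTensorProduct.of k C.deg (lamDeg k n)).symm.toLinearMap

lemma coeff_tm (fs : List (LamDual k n)) (a : C.carrier) (x : Lam k n) :
    coeff fs (tm C n a x) = contractList fs x • a := rfl

lemma tensorLam_hom_ext {M : Type*} [AddCommMonoid M] [Module k M] {f g : TensorLam C n →ₗ[k] M}
    (h : ∀ a x, f (tm C n a x) = g (tm C n a x)) : f = g :=
  (LinearEquiv.eq_comp_toLinearMap_iff (e₁₂ := GradedTensorProduct.of k C.deg (lamDeg k n)) f g).mp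
    (TensorProduct.ext' h)

lemma coeff_tensorMap (f : C ⟶ D) (α : m ⟶ n) (fs : List (LamDual k n)) (t : TensorLam C m) :
    coeff fs (tensorMap f α t) = CDGA.Hom.toAlgHom f (coeff (fs.map (pullback α)) t) := by
  have h : coeff fs ∘ₗ tensorMap f α =
      (CDGA.Hom.toAlgHom f).toLinearMap ∘ₗ coeff (fs.map (pullback α)) := by
    refine tensorLam_hom_ext fun a x => ?_
    simp only [LinearMap.comp_apply, tensorMap_tm, coeff_tm, AlgHom.toLinearMap_apply, map_smul,
      lamMap, contractList_map]
  exact LinearMap.congr_fun h t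

lemma coeff_mem (fs : List (LamDual k n)) {t : TensorLam C n} (ht : t ∈ tensorZero C n) :
    coeff fs t ∈ C.deg fs.length := by
  refine (Submodule.span_le (p := (C.deg fs.length).comap (coeff fs))).mpr ?_ ht
  rintro _ ⟨i, a, x, ha, hx, rfl⟩
  rw [SetLike.mem_coe, Submodule.mem_comap, coeff_tm]
  by_cases hi : i = fs.length
  · exact Submodule.smul_mem _ _ (hi ▸ ha)
  · rw [contractList_of_mem fs hx hi, zero_smul]
    exact zero_mem _

lemma coeff_tensorD (fs : List (LamDual k n)) {t : TensorLam C n} (ht : t ∈ tensorZero C n) :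
    coeff fs (tensorD C n t) =
      C.d (coeff fs t) + (-1 : k) ^ (fs.length + 1) • coeff (lamFunctional k n :: fs) t := by
  refine LinearMap.eqOn_span (f := coeff fs ∘ₗ tensorD C n)
    (g := C.d ∘ₗ coeff fs + (-1 : k) ^ (fs.length + 1) • coeff (lamFunctional k n :: fs)) ?_ ht
  rintro _ ⟨i, a, x, ha, hx, rfl⟩
  simp only [LinearMap.comp_apply, LinearMap.add_apply, LinearMap.smul_apply, tensorD_tm ha,
    map_add, map_smul, coeff_tm]
  change _ + (-1 : k) ^ i • contractList (lamFunctional k n :: fs) x • a = _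
  by_cases hi : i = fs.length + 1
  · rw [hi]
  · rw [contractList_of_mem (lamFunctional k n :: fs) hx hi, zero_smul, smul_zero, smul_zero]

lemma d_coeff (fs : List (LamDual k n)) (t : kSubalgebra C n) :
    C.d (coeff fs (t : TensorLam C n)) =
      (-1 : k) ^ fs.length • coeff (lamFunctional k n :: fs) (t : TensorLam C n) := by
  have h := coeff_tensorD fs t.2.1
  rw [t.2.2, map_zero] at h
  rw [eq_neg_of_add_eq_zero_left h.symm, pow_succ, mul_neg_one, neg_smul, neg_neg]

variable (k n) in
/-- The basis of `Λⁿ` formed by the monomials `e_{i₁} ⋯ e_{iₚ}` with `i₁ < ⋯ < iₚ`. -/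
def lamBasis : Module.Basis (Finset (Fin (n.len + 1))) k (Lam k n) :=
  (Finsupp.basisSingleOne (R := k) (ι := Fin (n.len + 1))).ExteriorAlgebra

/-- The list of functionals that reads off the coordinate at a monomial of `Λⁿ`. -/
def vertexCoords (S : Finset (Fin (n.len + 1))) : List (LamDual k n) :=
  coordList Finsupp.basisSingleOne S

lemma length_vertexCoords (S : Finset (Fin (n.len + 1))) :
    (vertexCoords S : List (LamDual k n)).length = S.card :=
  length_coordList _ S

lemma lamBasis_mem (S : Finset (Fin (n.len + 1))) : lamBasis k n S ∈ lamDeg k n S.card :=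
  basis_exteriorAlgebra_mem _ S

lemma contractList_vertexCoords (S : Finset (Fin (n.len + 1))) :
    contractList (vertexCoords S) = (lamBasis k n).coord S :=
  contractList_coordList _ S

lemma tensor_expansion (t : TensorLam C n) :
    t = ∑ S, tm C n (coeff (vertexCoords S) t) (lamBasis k n S) := by
  let tmRight (x : Lam k n) : C.carrier →ₗ[k] TensorLam C n :=
    ⟨⟨(tm C n · x), fun a b => add_tm a b x⟩, fun r a => smul_tm r a x⟩
  let tmLeft (a : C.carrier) : Lam k n →ₗ[k] TensorLam C n :=
    ⟨⟨tm C n a, tm_add a⟩, fun r => tm_smul r a⟩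
  suffices h : LinearMap.id = ∑ S, tmRight (lamBasis k n S) ∘ₗ coeff (vertexCoords S) by
    refine (LinearMap.congr_fun h t).trans ?_
    rw [LinearMap.sum_apply]
    rfl
  refine tensorLam_hom_ext fun a x => ?_
  calc tm C n a x = tmLeft a (∑ S, (lamBasis k n).repr x S • lamBasis k n S) := by
        rw [(lamBasis k n).sum_repr]; rfl
    _ = ∑ S, tm C n (coeff (vertexCoords S) (tm C n a x)) (lamBasis k n S) := by
        rw [map_sum]
        refine Finset.sum_congr rfl fun S _ => ?_
        rw [coeff_tm, contractList_vertexCoords, smul_tm, map_smul]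
        rfl
    _ = _ := by rw [LinearMap.sum_apply]; rfl

lemma tensor_ext {s t : TensorLam C n}
    (h : ∀ S, coeff (vertexCoords S) s = coeff (vertexCoords S) t) : s = t := by
  rw [tensor_expansion s, tensor_expansion t]
  exact Finset.sum_congr rfl fun S _ => by rw [h]

end Coefficients

section Join

/-- The join of two simplices. -/
def join (n m : SimplexCategory) : SimplexCategory := SimplexCategory.mk (n.len + m.len + 1)

/-- The inclusion of `[n]` as the initial vertices of the join of `[n]` and `[m]`. -/
def joinFst (n m : SimplexCategory) : n ⟶ join n m :=
  SimplexCategory.Hom.mk ⟨fun i => ⟨i.1, by change i.1 < n.len + m.len + 1 + 1; omega⟩,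
    fun _ _ h => h⟩

/-- The inclusion of `[m]` as the final vertices of the join of `[n]` and `[m]`. -/
def joinSnd (n m : SimplexCategory) : m ⟶ join n m :=
  SimplexCategory.Hom.mk ⟨fun i => ⟨n.len + 1 + i.1, by
      change n.len + 1 + i.1 < n.len + m.len + 1 + 1; omega⟩,
    fun _ _ h => Nat.add_le_add_left h _⟩

variable {n m : SimplexCategory}

lemma joinFst_injective : Function.Injective (joinFst n m).toOrderHom := fun i j h => by
  have hij : ((joinFst n m).toOrderHom i).1 = ((joinFst n m).toOrderHom j).1 := congrArg Fin.val h
  exact Fin.ext hij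

lemma joinSnd_injective : Function.Injective (joinSnd n m).toOrderHom := fun _ _ h =>
  Fin.ext (Nat.add_left_cancel (congrArg Fin.val h))

lemma joinFst_ne_joinSnd (i : Fin (n.len + 1)) (j : Fin (m.len + 1)) :
    (joinFst n m).toOrderHom i ≠ (joinSnd n m).toOrderHom j := fun h => by
  have hij : i.1 = n.len + 1 + j.1 := congrArg Fin.val h
  omega

/-- The extension of a functional by zero along an injective map of simplices. -/
def extendByZero (α : m ⟶ n) (hα : Function.Injective α.toOrderHom) (f : LamDual k m) :
    LamDual k n :=
  f ∘ₗ Finsupp.lcomapDomain _ hα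

lemma pullback_extendByZero (α : m ⟶ n) (hα : Function.Injective α.toOrderHom)
    (f : LamDual k m) : pullback α (extendByZero α hα f) = f :=
  LinearMap.ext fun v => congrArg f (Finsupp.comapDomain_mapDomain _ hα v)

lemma pullback_extendByZero_of_disjoint {l : SimplexCategory} (α : m ⟶ n) (β : l ⟶ n)
    (hα : Function.Injective α.toOrderHom) (h : ∀ i j, α.toOrderHom i ≠ β.toOrderHom j)
    (f : LamDual k m) : pullback β (extendByZero α hα f) = 0 := by
  refine LinearMap.ext fun v => (congrArg f (Finsupp.ext fun i => ?_)).trans (map_zero f)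
  exact Finsupp.mapDomain_of_notMem_range _ _ fun ⟨j, hj⟩ => h i j hj.symm

lemma map_pullback_map_extendByZero (α : m ⟶ n) (hα : Function.Injective α.toOrderHom)
    (fs : List (LamDual k m)) : (fs.map (extendByZero α hα)).map (pullback α) = fs := by
  rw [List.map_map]
  exact List.map_id'' (fun f => pullback_extendByZero α hα f) fs

/-- The list on the join whose coefficients are products of coefficients for `fs` and `gs`. -/
def joinList (fs : List (LamDual k n)) (gs : List (LamDual k m)) : List (LamDual k (join n m)) :=
  fs.map (extendByZero (joinFst n m) joinFst_injective) ++
    gs.map (extendByZero (joinSnd n m) joinSnd_injective)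

lemma contractList_joinList (fs : List (LamDual k n)) (gs : List (LamDual k m)) (x : Lam k n)
    (y : Lam k m) :
    contractList (joinList fs gs) (lamMap k (joinFst n m) x * lamMap k (joinSnd n m) y) =
      contractList fs x * contractList gs y := by
  have h := contractList_append_map_mul_map
    (fs := fs.map (extendByZero (joinFst n m) joinFst_injective))
    (gs := gs.map (extendByZero (joinSnd n m) joinSnd_injective))
    (List.forall_mem_map.mpr fun f _ =>
      pullback_extendByZero_of_disjoint _ (joinSnd n m) _ joinFst_ne_joinSnd f)
    (List.forall_mem_map.mpr fun g _ =>
      pullback_extendByZero_of_disjoint _ (joinFst n m) _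
        (fun i j h => joinFst_ne_joinSnd j i h.symm) g) x y
  rwa [map_pullback_map_extendByZero, map_pullback_map_extendByZero] at h

variable {C : CDGA k}

lemma coeff_joinList (fs : List (LamDual k n)) (gs : List (LamDual k m)) {s : TensorLam C n}
    (hs : s ∈ tensorZero C n) {t : TensorLam C m} (ht : t ∈ tensorZero C m) :
    coeff (joinList fs gs)
      (tensorMap (𝟙 C) (joinFst n m) s * tensorMap (𝟙 C) (joinSnd n m) t) =
      (-1 : k) ^ (fs.length * gs.length) • (coeff fs s * coeff gs t) := by
  induction hs, ht using Submodule.span_induction₂ with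
  | mem_mem s t hs ht =>
    obtain ⟨i, a, x, -, hx, rfl⟩ := hs
    obtain ⟨j, b, y, hb, hy, rfl⟩ := ht
    rw [tensorMap_tm, tensorMap_tm, tm_mul_tm _ (lamMap_mem _ hx) (CDGA.Hom.map_deg (𝟙 C) j b hb),
      map_smul, coeff_tm, coeff_tm, coeff_tm, contractList_joinList, smul_mul_smul_comm]
    by_cases hi : i = fs.length
    · by_cases hj : j = gs.length
      · rw [hi, hj]; rfl
      · simp only [contractList_of_mem gs hy hj, mul_zero, zero_smul, smul_zero]
    · simp only [contractList_of_mem fs hx hi, zero_mul, zero_smul, smul_zero]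
  | zero_left | zero_right => simp only [map_zero, zero_mul, mul_zero, smul_zero]
  | add_left | add_right => simp only [add_mul, mul_add, map_add, smul_add, *]
  | smul_left r | smul_right r =>
    simp only [smul_mul_assoc, mul_smul_comm, map_smul, *, smul_comm r]

end Join

/-! ### Nilpotence of the augmentation ideals of `K(C)` -/

section Nilpotent

variable {C : CDGA k} {n : SimplexCategory}

/-- The part of `(C ⊗ Λⁿ)⁰` in `C`-degree at least `j`. -/
def tensorFil (C : CDGA k) (n : SimplexCategory) (j : ℕ) : Submodule k (TensorLam C n) :=
  Submodule.span k {t | ∃ (i : ℕ) (a : C.carrier) (x : Lam k n),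
    j ≤ i ∧ a ∈ C.deg i ∧ x ∈ lamDeg k n i ∧ t = tm C n a x}

lemma tensorFil_zero : tensorFil C n 0 = tensorZero C n := by
  simp only [tensorZero, tensorFil, zero_le, true_and]

lemma tensorFil_mul_le (i j : ℕ) : tensorFil C n i * tensorFil C n j ≤ tensorFil C n (i + j) := by
  rw [tensorFil, tensorFil, Submodule.span_mul_span, Submodule.span_le]
  rintro _ ⟨_, ⟨p, a, x, hp, ha, hx, rfl⟩, _, ⟨q, b, y, hq, hb, hy, rfl⟩, rfl⟩
  simp only [tm_mul_tm a hx hb y]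
  exact Submodule.smul_mem _ _ (Submodule.subset_span ⟨p + q, _, _, add_le_add hp hq,
    SetLike.mul_mem_graded ha hb, SetLike.mul_mem_graded hx hy, rfl⟩)

lemma coeff_of_mem_tensorFil (fs : List (LamDual k n)) {j : ℕ} (hj : fs.length < j)
    {t : TensorLam C n} (ht : t ∈ tensorFil C n j) : coeff fs t = 0 := by
  refine (Submodule.span_le (p := LinearMap.ker (coeff fs))).mpr ?_ ht
  rintro _ ⟨i, a, x, hi, -, hx, rfl⟩
  rw [SetLike.mem_coe, LinearMap.mem_ker, coeff_tm, contractList_of_mem fs hx (by omega),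
    zero_smul]

lemma coeff_nil_of_mem_augIdeal {t : kSubalgebra C n} (ht : t ∈ augIdeal ((Kalg k).obj C) n) :
    coeff [] (t : TensorLam C n) = 0 := by
  have h : tensorMap (𝟙 C) (SimplexCategory.isTerminalZero.from n) (t : TensorLam C n) = 0 :=
    congrArg Subtype.val ht
  exact (coeff_tensorMap (𝟙 C) (SimplexCategory.isTerminalZero.from n) [] _).symm.trans
    (by rw [h, map_zero])

lemma coe_mem_tensorFil_one {t : kSubalgebra C n} (ht : t ∈ augIdeal ((Kalg k).obj C) n) :
    (t : TensorLam C n) ∈ tensorFil C n 1 := by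
  rw [tensor_expansion (t : TensorLam C n)]
  refine Submodule.sum_mem _ fun S _ => ?_
  obtain rfl | hS := S.eq_empty_or_nonempty
  · have h : coeff (vertexCoords ∅) (t : TensorLam C n) = 0 := by
      simpa [vertexCoords, coordList] using coeff_nil_of_mem_augIdeal ht
    rw [h, ← zero_smul k (0 : C.carrier), smul_tm, zero_smul]
    exact zero_mem _
  · exact Submodule.subset_span ⟨S.card, _, _, hS.card_pos,
      length_vertexCoords (k := k) S ▸ coeff_mem (vertexCoords S) t.2.1, lamBasis_mem S, rfl⟩

lemma coe_mem_tensorFil (j : ℕ) {t : kSubalgebra C n}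
    (ht : t ∈ augIdeal ((Kalg k).obj C) n ^ j) : (t : TensorLam C n) ∈ tensorFil C n j := by
  induction j generalizing t with
  | zero => exact tensorFil_zero.ge t.2.1
  | succ j ih =>
    rw [pow_succ] at ht
    induction ht using Submodule.mul_induction_on' with
    | mem_mul_mem a ha b hb =>
      exact tensorFil_mul_le j 1 (Submodule.mul_mem_mul (ih ha) (coe_mem_tensorFil_one hb))
    | add x _ y _ hx hy => exact add_mem hx hy

lemma coeff_of_mem_augIdeal_pow (fs : List (LamDual k n)) {j : ℕ} (hj : fs.length < j)
    {t : kSubalgebra C n} (ht : t ∈ augIdeal ((Kalg k).obj C) n ^ j) :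
    coeff fs (t : TensorLam C n) = 0 :=
  coeff_of_mem_tensorFil fs hj (coe_mem_tensorFil j ht)

lemma augIdeal_Kalg_pow (C : CDGA k) (n : SimplexCategory) :
    augIdeal ((Kalg k).obj C) n ^ (n.len + 2) = ⊥ := by
  refine (Submodule.eq_bot_iff _).mpr fun t ht => Subtype.ext (tensor_ext fun S => ?_)
  have hS : (vertexCoords S : List (LamDual k n)).length < n.len + 2 := by
    rw [length_vertexCoords]
    exact Nat.lt_succ_of_le (S.card_le_univ.trans_eq (Fintype.card_fin _))
  rw [coeff_of_mem_augIdeal_pow _ hS ht]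
  exact (map_zero _).symm

end Nilpotent

/-! ### The left adjoint of `K` -/

section OfEmbedding

variable {X : Type u} [Ring X] [Algebra k X] {I : Type*} (C : I → CDGA k)
  (ψ : ∀ i, X →ₐ[k] (C i).carrier)

/-- The elements of `X` all of whose components, along a family of morphisms to cdgas, are of
degree `n`. -/
def jointDeg (n : ℕ) : Submodule k X := ⨅ i, ((C i).deg n).comap (ψ i).toLinearMap

lemma mem_jointDeg {n : ℕ} {x : X} : x ∈ jointDeg C ψ n ↔ ∀ i, ψ i x ∈ (C i).deg n := by
  simp [jointDeg]

lemma decompose_component (i : I) (x : DirectSum ℕ fun n => jointDeg C ψ n) (n : ℕ) :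
    (DirectSum.decompose (C i).deg (ψ i (DirectSum.coeLinearMap (jointDeg C ψ) x)) n :
      (C i).carrier) = ψ i (x n) := by
  induction x using DirectSum.induction_on with
  | zero => simp
  | of m x =>
    have h := (mem_jointDeg C ψ).mp x.2 i
    rw [DirectSum.coeLinearMap_of, DirectSum.decompose_of_mem _ h]
    by_cases hm : m = n
    · subst hm
      rw [DirectSum.of_eq_same, DirectSum.of_eq_same]
    · rw [DirectSum.of_eq_of_ne _ _ _ (Ne.symm hm), DirectSum.of_eq_of_ne _ _ _ (Ne.symm hm)]
      exact (map_zero (ψ i)).symm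
  | add x y hx hy =>
    rw [map_add, map_add, DirectSum.decompose_add, DirectSum.add_apply, DirectSum.add_apply,
      Submodule.coe_add, Submodule.coe_add, map_add, hx, hy]

variable (inj : ∀ x, (∀ i, ψ i x = 0) → x = 0) (d : X →ₗ[k] X)
  (hd : ∀ i x, ψ i (d x) = (C i).d (ψ i x)) (hsum : ⨆ n, jointDeg C ψ n = ⊤)

include inj hsum in
lemma jointDeg_isInternal : DirectSum.IsInternal (jointDeg C ψ) := by
  constructor
  · refine (injective_iff_map_eq_zero _).mpr fun x hx => ?_
    have hx' : DirectSum.coeLinearMap (jointDeg C ψ) x = 0 := hx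
    refine DFinsupp.ext fun n => Subtype.ext (inj _ fun i => ?_)
    rw [← decompose_component C ψ i x n, hx', map_zero, DirectSum.decompose_zero]
    rfl
  · exact LinearMap.range_eq_top.mp (DirectSum.range_coeLinearMap.trans hsum)

/-- The cdga structure on an algebra `X` induced by a jointly injective family of morphisms to cdgas
which commute with a given endomorphism `d` of `X`. -/
def CDGA.ofEmbedding : CDGA k :=
  letI : DirectSum.Decomposition (jointDeg C ψ) :=
    (jointDeg_isInternal C ψ inj hsum).chooseDecomposition
  { carrier := X
    deg := jointDeg C ψ
    graded :=
      { one_mem := (mem_jointDeg C ψ).mpr fun i => by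
          rw [map_one]; exact SetLike.one_mem_graded _
        mul_mem := fun a b x y hx hy => (mem_jointDeg C ψ).mpr fun i => by
          rw [map_mul]
          exact SetLike.mul_mem_graded ((mem_jointDeg C ψ).mp hx i) ((mem_jointDeg C ψ).mp hy i) }
    d := d
    d_mem := fun n x hx => (mem_jointDeg C ψ).mpr fun i => by
      rw [hd]; exact (C i).d_mem n _ ((mem_jointDeg C ψ).mp hx i)
    d_d := fun x => inj _ fun i => by rw [hd, hd, (C i).d_d]
    leibniz := fun m x y hx => sub_eq_zero.mp <| inj _ fun i => by
      simp only [map_sub, map_add, map_mul, map_smul, hd]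
      rw [(C i).leibniz m _ _ ((mem_jointDeg C ψ).mp hx i), sub_self]
    comm := fun m n x y hx hy => sub_eq_zero.mp <| inj _ fun i => by
      simp only [map_sub, map_mul, map_smul]
      rw [(C i).comm m n _ _ ((mem_jointDeg C ψ).mp hx i) ((mem_jointDeg C ψ).mp hy i), sub_self] }

/-- The members of the defining family of `CDGA.ofEmbedding`, as morphisms of cdgas. -/
def CDGA.ofEmbeddingProj (i : I) : CDGA.ofEmbedding C ψ inj d hd hsum ⟶ C i :=
  (⟨ψ i, fun _ _ hx => (mem_jointDeg C ψ).mp hx i, hd i⟩ : CDGA.Hom _ _)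

end OfEmbedding

section CoeffHom

variable {A : CosimpAlg k} {C D : CDGA k} {m n : SimplexCategory} (φ : A ⟶ (Kalg k).obj C)

/-- The algebra morphism `Aⁿ → Kⁿ(C)` underlying a morphism `A ⟶ K(C)`. -/
def evalAt (n : SimplexCategory) : A.obj n →ₐ[k] kSubalgebra C n := (φ.app n).hom

/-- The coefficients in `C` of the elements of `C ⊗ Λⁿ` that a morphism `A ⟶ K(C)` assigns to
elements of `Aⁿ`. -/
def coeffHom (fs : List (LamDual k n)) : A.obj n →ₗ[k] C.carrier :=
  coeff fs ∘ₗ (kSubalgebra C n).val.toLinearMap ∘ₗ (evalAt φ n).toLinearMap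

lemma coeffHom_apply (fs : List (LamDual k n)) (a : A.obj n) :
    coeffHom φ fs a = coeff fs (evalAt φ n a : TensorLam C n) := rfl

lemma evalAt_map (α : m ⟶ n) (a : A.obj m) :
    (evalAt φ n ((A.map α).hom a) : TensorLam C n) = tensorMap (𝟙 C) α (evalAt φ m a) :=
  congrArg Subtype.val (CategoryTheory.congr_fun (φ.naturality α) a)

lemma coeffHom_map (α : m ⟶ n) (fs : List (LamDual k n)) (a : A.obj m) :
    coeffHom φ fs ((A.map α).hom a) = coeffHom φ (fs.map (pullback α)) a := by
  rw [coeffHom_apply, evalAt_map, coeff_tensorMap]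
  rfl

lemma pullback_id : pullback (k := k) (𝟙 n) = id := by
  have h : Finsupp.lmapDomain k k (SimplexCategory.Hom.toOrderHom (𝟙 n)) = LinearMap.id :=
    Finsupp.lmapDomain_id k k
  exact funext fun f => by rw [pullback, h]; rfl

lemma coeff_tensorMap_id (f : C ⟶ D) (fs : List (LamDual k n)) (t : TensorLam C n) :
    coeff fs (tensorMap f (𝟙 n) t) = CDGA.Hom.toAlgHom f (coeff fs t) := by
  rw [coeff_tensorMap, pullback_id, List.map_id]

lemma coeffHom_comp_map (f : C ⟶ D) (fs : List (LamDual k n)) (a : A.obj n) :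
    coeffHom (φ ≫ (Kalg k).map f) fs a = CDGA.Hom.toAlgHom f (coeffHom φ fs a) :=
  coeff_tensorMap_id f fs _

lemma coeffHom_mem (fs : List (LamDual k n)) (a : A.obj n) :
    coeffHom φ fs a ∈ C.deg fs.length :=
  coeff_mem fs (evalAt φ n a).2.1

lemma d_coeffHom (fs : List (LamDual k n)) (a : A.obj n) :
    C.d (coeffHom φ fs a) = (-1 : k) ^ fs.length • coeffHom φ (lamFunctional k n :: fs) a :=
  d_coeff fs (evalAt φ n a)

lemma coeffHom_mul_coeffHom (fs : List (LamDual k m)) (gs : List (LamDual k n)) (a : A.obj m)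
    (b : A.obj n) : coeffHom φ fs a * coeffHom φ gs b = (-1 : k) ^ (fs.length * gs.length) •
      coeffHom φ (joinList fs gs)
        ((A.map (joinFst m n)).hom a * (A.map (joinSnd m n)).hom b) := by
  have h := coeff_joinList fs gs (evalAt φ m a).2.1 (evalAt φ n b).2.1
  rw [← evalAt_map, ← evalAt_map, ← Subalgebra.coe_mul, ← map_mul] at h
  rw [coeffHom_apply φ (joinList fs gs), h, smul_smul, ← mul_pow, neg_mul_neg, one_mul, one_pow,
    one_smul]
  rfl

lemma coeffHom_one : coeffHom φ ([] : List (LamDual k n)) 1 = 1 := by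
  rw [coeffHom_apply, map_one]
  change coeff [] (tm C n 1 1) = 1
  rw [coeff_tm, contractList_nil, map_one, one_smul]

lemma coeffHom_of_mem_augIdeal_pow (fs : List (LamDual k n)) {j : ℕ} (hj : fs.length < j)
    {a : A.obj n} (ha : a ∈ augIdeal A n ^ j) : coeffHom φ fs a = 0 :=
  coeff_of_mem_augIdeal_pow fs hj
    (((Ideal.pow_right_mono (augIdeal_app φ n) j).trans (Ideal.le_comap_pow _ j)) ha)

end CoeffHom

section LeftAdjoint

variable (A : CosimpAlg k)

/-- The cdgas `C` under `A`, that is, with a morphism `A ⟶ K(C)`. -/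
abbrev CDGAUnder : Type (u + 1) := Σ C : CDGA k, A ⟶ (Kalg k).obj C

/-- The product of all cdgas under `A`. The cdga `D(A)` is realised as a subalgebra of it, which is
small although the product is not. -/
abbrev UnderProd : Type (u + 1) := (c : CDGAUnder A) → c.1.carrier

/-- The index set of the generators of `D(A)`: elements of the algebras `Aⁿ` together with a list
of functionals that selects one of their coefficients. -/
abbrev GenIndex : Type u := Σ n : SimplexCategory, A.obj n × List (LamDual k n)

variable {A}

/-- A coefficient of an element of `A`, in all cdgas under `A` at once. -/
def gen (g : GenIndex A) : UnderProd A := fun c => coeffHom c.2 g.2.2 g.2.1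

lemma gen_one : gen (A := A) ⟨SimplexCategory.mk 0, 1, []⟩ = 1 :=
  funext fun c => coeffHom_one c.2

lemma span_gen_mul_le : Submodule.span k (Set.range (gen (A := A))) *
    Submodule.span k (Set.range gen) ≤ Submodule.span k (Set.range gen) := by
  rw [Submodule.span_mul_span, Submodule.span_le]
  rintro _ ⟨_, ⟨⟨m, a, fs⟩, rfl⟩, _, ⟨⟨n, b, gs⟩, rfl⟩, rfl⟩
  have h : gen ⟨m, a, fs⟩ * gen ⟨n, b, gs⟩ = (-1 : k) ^ (fs.length * gs.length) •
      gen ⟨join m n, (A.map (joinFst m n)).hom a * (A.map (joinSnd m n)).hom b, joinList fs gs⟩ :=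
    funext fun c => coeffHom_mul_coeffHom c.2 fs gs a b
  change gen _ * gen _ ∈ _
  rw [h]
  exact Submodule.smul_mem _ _ (Submodule.subset_span ⟨_, rfl⟩)

variable (A)

/-- The subalgebra of the product of all cdgas under `A` spanned by the coefficients. -/
def genSubalgebra : Subalgebra k (UnderProd A) :=
  (Submodule.span k (Set.range (gen (A := A)))).toSubalgebra
    (Submodule.subset_span ⟨_, gen_one⟩)
    fun _ _ hx hy => span_gen_mul_le (Submodule.mul_mem_mul hx hy)

/-- The componentwise differential. -/
def underProdD : UnderProd A →ₗ[k] UnderProd A :=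
  LinearMap.pi fun c => c.1.d ∘ₗ LinearMap.proj c

variable {A}

lemma gen_mem (g : GenIndex A) : gen g ∈ genSubalgebra A := Submodule.subset_span ⟨g, rfl⟩

lemma underProdD_mem {x : UnderProd A} (hx : x ∈ genSubalgebra A) :
    underProdD A x ∈ genSubalgebra A := by
  refine (Submodule.span_le
    (p := (Subalgebra.toSubmodule (genSubalgebra A)).comap (underProdD A))).mpr ?_ hx
  rintro _ ⟨⟨n, a, fs⟩, rfl⟩
  have h : underProdD A (gen ⟨n, a, fs⟩) =
      (-1 : k) ^ fs.length • gen ⟨n, a, lamFunctional k n :: fs⟩ :=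
    funext fun c => d_coeffHom c.2 fs a
  change underProdD A (gen _) ∈ genSubalgebra A
  rw [h]
  exact Subalgebra.smul_mem _ (gen_mem _) _

instance : Small.{u} (genSubalgebra A) := by
  have h : (genSubalgebra A : Set (UnderProd A)) = Set.range (Finsupp.linearCombination k gen) := by
    rw [← LinearMap.coe_range, Finsupp.range_linearCombination]
    rfl
  change Small.{u} (genSubalgebra A : Set (UnderProd A))
  exact h ▸ small_range _

variable (A)

/-- The underlying algebra of `D(A)`, in the universe of `A`. -/
abbrev DCarrier : Type u := Shrink.{u} (genSubalgebra A)

/-- The identification of the algebra of `D(A)` with a subalgebra of a product of cdgas. -/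
def dEquiv : DCarrier A ≃ₐ[k] genSubalgebra A := Shrink.algEquiv k (genSubalgebra A)

/-- The differential of `D(A)`. -/
def dDiff : DCarrier A →ₗ[k] DCarrier A :=
  (dEquiv A).symm.toLinearMap ∘ₗ
    ((underProdD A).restrict (p := Subalgebra.toSubmodule (genSubalgebra A))
      (q := Subalgebra.toSubmodule (genSubalgebra A)) fun _ h => underProdD_mem h) ∘ₗ
      (dEquiv A).toLinearMap

variable {A}

/-- The component of the algebra of `D(A)` at a cdga under `A`. -/
def dProj (c : CDGAUnder A) : DCarrier A →ₐ[k] c.1.carrier :=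
  (Pi.evalAlgHom k _ c).comp ((genSubalgebra A).val.comp (dEquiv A).toAlgHom)

/-- The generators of `D(A)`. -/
def dGen (g : GenIndex A) : DCarrier A := (dEquiv A).symm ⟨gen g, gen_mem g⟩

lemma dProj_apply (c : CDGAUnder A) (x : DCarrier A) : dProj c x = (dEquiv A x).1 c := rfl

lemma eq_zero_of_dProj_eq_zero (x : DCarrier A) (h : ∀ c, dProj c x = 0) : x = 0 :=
  (dEquiv A).injective (Subtype.ext (funext fun c => (h c).trans (by rw [map_zero]; rfl)))

lemma dProj_dDiff (c : CDGAUnder A) (x : DCarrier A) :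
    dProj c (dDiff A x) = c.1.d (dProj c x) := by
  rw [dProj_apply, dDiff, LinearMap.comp_apply, AlgEquiv.toLinearMap_apply,
    AlgEquiv.apply_symm_apply]
  rfl

lemma dProj_dGen (c : CDGAUnder A) (g : GenIndex A) :
    dProj c (dGen g) = coeffHom c.2 g.2.2 g.2.1 := by
  rw [dProj_apply, dGen, AlgEquiv.apply_symm_apply]
  rfl

lemma dGen_mem (g : GenIndex A) :
    dGen g ∈ jointDeg (fun c : CDGAUnder A => c.1) dProj g.2.2.length :=
  (mem_jointDeg _ _).mpr fun c => dProj_dGen c g ▸ coeffHom_mem c.2 g.2.2 g.2.1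

lemma span_dGen : Submodule.span k (Set.range (dGen (A := A))) = ⊤ := by
  have h : Set.range (dGen (A := A)) = (dEquiv A).symm.toLinearMap ''
      (Subtype.val ⁻¹' Set.range (gen (A := A))) := by
    ext x
    constructor
    · rintro ⟨g, rfl⟩
      exact ⟨_, ⟨g, rfl⟩, rfl⟩
    · rintro ⟨⟨_, _⟩, ⟨g, rfl⟩, rfl⟩
      exact ⟨g, rfl⟩
  rw [h, Submodule.span_image]
  have hgen : Submodule.span k (Subtype.val ⁻¹' Set.range (gen (A := A)) :
      Set (genSubalgebra A)) = ⊤ := Submodule.span_span_coe_preimage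
  rw [hgen, Submodule.map_top]
  exact LinearMap.range_eq_top.mpr (dEquiv A).symm.surjective

lemma iSup_jointDeg : ⨆ n, jointDeg (fun c : CDGAUnder A => c.1) dProj n = ⊤ := by
  rw [eq_top_iff, ← span_dGen, Submodule.span_le]
  rintro _ ⟨g, rfl⟩
  exact Submodule.mem_iSup_of_mem _ (dGen_mem g)

variable (A) in
/-- The value at `A` of the left adjoint of `K`. -/
def dObj : CDGA k :=
  CDGA.ofEmbedding (fun c : CDGAUnder A => c.1) dProj eq_zero_of_dProj_eq_zero (dDiff A) dProj_dDiff
    iSup_jointDeg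

/-- The morphism `D(A) ⟶ C` that corresponds to a morphism `A ⟶ K(C)`. -/
def dObjProj (c : CDGAUnder A) : dObj A ⟶ c.1 :=
  CDGA.ofEmbeddingProj _ _ _ _ _ _ c

lemma dObj_ext {x y : (dObj A).carrier}
    (h : ∀ c, CDGA.Hom.toAlgHom (dObjProj c) x = CDGA.Hom.toAlgHom (dObjProj c) y) : x = y :=
  sub_eq_zero.mp (eq_zero_of_dProj_eq_zero _ fun c =>
    (map_sub (CDGA.Hom.toAlgHom (dObjProj c)) x y).trans (sub_eq_zero.mpr (h c)))

/-- The generators of the cdga `D(A)`. -/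
def dObjGen (g : GenIndex A) : (dObj A).carrier := dGen g

lemma dObjProj_gen (c : CDGAUnder A) (g : GenIndex A) :
    CDGA.Hom.toAlgHom (dObjProj c) (dObjGen g) = coeffHom c.2 g.2.2 g.2.1 := dProj_dGen c g

lemma dObjGen_mem (g : GenIndex A) : dObjGen g ∈ (dObj A).deg g.2.2.length := dGen_mem g

lemma span_dObjGen : Submodule.span k (Set.range (dObjGen (A := A))) = ⊤ := span_dGen

variable {m n : SimplexCategory}

lemma dObj_tensor_ext {s t : TensorLam (dObj A) n}
    (h : ∀ c : CDGAUnder A, tensorMap (dObjProj c) (𝟙 n) s = tensorMap (dObjProj c) (𝟙 n) t) :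
    s = t :=
  tensor_ext fun S => dObj_ext fun c => by
    rw [← coeff_tensorMap_id, ← coeff_tensorMap_id, h c]

lemma kSubalgebra_dObj_ext {s t : kSubalgebra (dObj A) n}
    (h : ∀ c : CDGAUnder A, kMap (dObjProj c) (𝟙 n) s = kMap (dObjProj c) (𝟙 n) t) : s = t :=
  Subtype.ext (dObj_tensor_ext fun c => congrArg Subtype.val (h c))

/-- The element of `D(A) ⊗ Λⁿ` with the coefficients prescribed by an element of `Aⁿ`. -/
def unitTensor (a : A.obj n) : TensorLam (dObj A) n :=
  ∑ S, tm (dObj A) n (dObjGen ⟨n, a, vertexCoords S⟩) (lamBasis k n S)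

lemma tensorMap_unitTensor (c : CDGAUnder A) (a : A.obj n) :
    tensorMap (dObjProj c) (𝟙 n) (unitTensor a) = evalAt c.2 n a := by
  rw [tensor_expansion (evalAt c.2 n a : TensorLam c.1 n), unitTensor, map_sum]
  refine Finset.sum_congr rfl fun S _ => ?_
  rw [tensorMap_tm, lamMap_id, dObjProj_gen]
  rfl

lemma unitTensor_mem (a : A.obj n) : unitTensor a ∈ kSubalgebra (dObj A) n := by
  have hzero : unitTensor a ∈ tensorZero (dObj A) n :=
    Submodule.sum_mem _ fun S _ => Submodule.subset_span ⟨S.card, _, _,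
      length_vertexCoords (k := k) S ▸ dObjGen_mem ⟨n, a, vertexCoords S⟩, lamBasis_mem S, rfl⟩
  refine ⟨hzero, dObj_tensor_ext fun c => ?_⟩
  rw [tensorMap_tensorD _ _ hzero, tensorMap_unitTensor, map_zero]
  exact (evalAt c.2 n a).2.2

lemma kMap_unitTensor (c : CDGAUnder A) (a : A.obj n) :
    kMap (dObjProj c) (𝟙 n) ⟨unitTensor a, unitTensor_mem a⟩ = evalAt c.2 n a :=
  Subtype.ext (tensorMap_unitTensor c a)

variable (A n) in
/-- The unit of the adjunction at `[n]`. -/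
def dUnitHom : A.obj n →ₐ[k] kSubalgebra (dObj A) n where
  toFun a := ⟨unitTensor a, unitTensor_mem a⟩
  map_one' := kSubalgebra_dObj_ext fun c => by simp only [kMap_unitTensor, map_one]
  map_mul' a b := kSubalgebra_dObj_ext fun c => by simp only [kMap_unitTensor, map_mul]
  map_zero' := kSubalgebra_dObj_ext fun c => by simp only [kMap_unitTensor, map_zero]
  map_add' a b := kSubalgebra_dObj_ext fun c => by simp only [kMap_unitTensor, map_add]
  commutes' r := kSubalgebra_dObj_ext fun c => by simp only [kMap_unitTensor, AlgHom.commutes]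

lemma kMap_dUnitHom (c : CDGAUnder A) (a : A.obj n) :
    kMap (dObjProj c) (𝟙 n) (dUnitHom A n a) = evalAt c.2 n a := kMap_unitTensor c a

lemma coeff_dUnitHom (fs : List (LamDual k n)) (a : A.obj n) :
    coeff fs (dUnitHom A n a : TensorLam (dObj A) n) = dObjGen ⟨n, a, fs⟩ :=
  dObj_ext fun c => by
    rw [← coeff_tensorMap_id, ← kMap_coe, kMap_dUnitHom, dObjProj_gen]
    rfl

lemma dObjGen_map (α : m ⟶ n) (fs : List (LamDual k n)) (a : A.obj m) :
    dObjGen ⟨n, (A.map α).hom a, fs⟩ = dObjGen ⟨m, a, fs.map (pullback α)⟩ :=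
  dObj_ext fun c => by
    rw [dObjProj_gen, dObjProj_gen]
    exact coeffHom_map c.2 α fs a

variable (A) in
/-- The unit of the adjunction. -/
def dUnit : A ⟶ (Kalg k).obj (dObj A) where
  app n := CommAlgCat.ofHom (dUnitHom A n)
  naturality m n α := by
    refine CommAlgCat.hom_ext (AlgHom.ext fun a => Subtype.ext (tensor_ext fun S => ?_))
    change coeff _ (dUnitHom A n ((A.map α).hom a) : TensorLam (dObj A) n) =
      coeff _ (tensorMap (𝟙 _) α (dUnitHom A m a))
    rw [coeff_tensorMap, coeff_dUnitHom, coeff_dUnitHom, dObjGen_map]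
    rfl

lemma coeffHom_dUnit (g : GenIndex A) : coeffHom (dUnit A) g.2.2 g.2.1 = dObjGen g :=
  coeff_dUnitHom g.2.2 g.2.1

lemma dUnit_comp_map_dObjProj (c : CDGAUnder A) : dUnit A ≫ (Kalg k).map (dObjProj c) = c.2 :=
  NatTrans.ext (funext fun _ => CommAlgCat.hom_ext (AlgHom.ext fun a => kMap_dUnitHom c a))

/-- The universal property of `D(A)`. -/
def dHomEquiv (A : CosimpAlg k) (C : CDGA k) : (dObj A ⟶ C) ≃ (A ⟶ (Kalg k).obj C) where
  toFun f := dUnit A ≫ (Kalg k).map f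
  invFun φ := dObjProj ⟨C, φ⟩
  left_inv f := by
    refine CDGA.Hom.ext (AlgHom.toLinearMap_injective (LinearMap.ext_on span_dObjGen ?_))
    rintro _ ⟨g, rfl⟩
    change CDGA.Hom.toAlgHom (dObjProj ⟨C, dUnit A ≫ (Kalg k).map f⟩) (dObjGen g) =
      CDGA.Hom.toAlgHom f (dObjGen g)
    rw [dObjProj_gen, coeffHom_comp_map, coeffHom_dUnit]
  right_inv φ := dUnit_comp_map_dObjProj ⟨C, φ⟩

variable (k) in
lemma isRightAdjoint_Kalg : (Kalg k).IsRightAdjoint :=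
  ⟨_, ⟨Adjunction.adjunctionOfEquivLeft dHomEquiv fun A C C' f g => by
    simp only [dHomEquiv, Equiv.coe_fn_mk, Functor.map_comp, Category.assoc]⟩⟩

end LeftAdjoint

/-! ### Generation of the left adjoint -/

section Generation

lemma le_span_image_of_span_range_eq_top {R M ι κ : Type*} [CommRing R] [AddCommGroup M]
    [Module R M] [DecidableEq ι] (ℳ : ι → Submodule R M) [DirectSum.Decomposition ℳ]
    {g : κ → M} {l : κ → ι} (hg : ∀ j, g j ∈ ℳ (l j))
    (hspan : Submodule.span R (Set.range g) = ⊤) (i : ι) :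
    ℳ i ≤ Submodule.span R (g '' {j | l j = i}) := by
  let π : M →ₗ[R] M := (ℳ i).subtype ∘ₗ DirectSum.component R ι (fun i => ℳ i) i ∘ₗ
    (DirectSum.decomposeLinearEquiv ℳ).toLinearMap
  have hπ (x : M) : π x = DirectSum.decompose ℳ x i := rfl
  have hle : (Submodule.span R (Set.range g)).map π ≤ Submodule.span R (g '' {j | l j = i}) := by
    rw [Submodule.map_span_le]
    rintro _ ⟨j, rfl⟩
    by_cases hj : l j = i
    · rw [hπ, DirectSum.decompose_of_mem_same ℳ (hj ▸ hg j)]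
      exact Submodule.subset_span ⟨j, hj, rfl⟩
    · rw [hπ, DirectSum.decompose_of_mem_ne ℳ (hg j) hj]
      exact zero_mem _
  intro x hx
  have h : π x ∈ (Submodule.span R (Set.range g)).map π := ⟨x, by rw [hspan]; trivial, rfl⟩
  rw [hπ, DirectSum.decompose_of_mem_same ℳ hx] at h
  exact hle h

lemma deg_dObj_le (A : CosimpAlg k) (p : ℕ) :
    (dObj A).deg p ≤ Submodule.span k (dObjGen '' {g | g.2.2.length = p}) :=
  le_span_image_of_span_range_eq_top (dObj A).deg dObjGen_mem span_dObjGen p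

variable {D : CosimpAlg k ⥤ CDGA k} (adj : D ⊣ Kalg k) {A : CosimpAlg k}

/-- `D(A)` is a retract of `dObj A` under `A`, so it inherits the generators of the latter. -/
lemma deg_le_span_coeffHom (p : ℕ) :
    (D.obj A).deg p ≤ Submodule.span k
      ((fun g : GenIndex A => coeffHom (adj.unit.app A) g.2.2 g.2.1) ''
        {g | g.2.2.length = p}) := by
  let f : dObj A ⟶ D.obj A := dObjProj ⟨_, adj.unit.app A⟩
  let g : D.obj A ⟶ dObj A := (adj.homEquiv A (dObj A)).symm (dUnit A)
  have hf : dUnit A ≫ (Kalg k).map f = adj.unit.app A := dUnit_comp_map_dObjProj _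
  have hg : adj.unit.app A ≫ (Kalg k).map g = dUnit A :=
    (adj.homEquiv_unit A _ g).symm.trans (Equiv.apply_symm_apply _ _)
  have hgf : g ≫ f = 𝟙 _ := (adj.homEquiv A _).injective <| by
    rw [adj.homEquiv_unit, adj.homEquiv_unit, Functor.map_comp, reassoc_of% hg, hf]
    simp only [Functor.comp_obj, CategoryTheory.Functor.map_id, Category.comp_id]
  intro x hx
  have hx' : CDGA.Hom.toAlgHom f (CDGA.Hom.toAlgHom g x) = x :=
    congrArg (fun h : D.obj A ⟶ D.obj A => CDGA.Hom.toAlgHom h x) hgf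
  have h := Submodule.mem_map_of_mem (f := (CDGA.Hom.toAlgHom f).toLinearMap)
    (deg_dObj_le A p (CDGA.Hom.map_deg g p x hx))
  have hgen : (CDGA.Hom.toAlgHom f).toLinearMap ∘ dObjGen =
      fun y : GenIndex A => coeffHom (adj.unit.app A) y.2.2 y.2.1 :=
    funext (dObjProj_gen ⟨_, adj.unit.app A⟩)
  rw [Submodule.map_span, ← Set.image_comp, hgen] at h
  exact hx' ▸ h

end Generation

section OddCoords

variable {n : SimplexCategory}

lemma card_filter_le_eq {α : Type*} [LinearOrder α] (S : Finset α) (a : α) :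
    (S.filter (· ≤ a)).card = (S.filter (· < a)).card + if a ∈ S then 1 else 0 := by
  have h : S.filter (· ≤ a) = S.filter (· < a) ∪ S.filter (· = a) := by
    ext x
    simp only [Finset.mem_filter, Finset.mem_union, le_iff_lt_or_eq, and_or_left]
  rw [h, Finset.card_union_of_disjoint
    (Finset.disjoint_filter.mpr fun x _ hlt heq => hlt.ne heq), Finset.filter_eq']
  split_ifs <;> simp

lemma card_filter_lt_orderEmbOfFin {α : Type*} [LinearOrder α] (S : Finset α)
    (i : Fin S.card) : (S.filter (· < S.orderEmbOfFin rfl i)).card = i := by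
  have h : S.filter (· < S.orderEmbOfFin rfl i) =
      (Finset.Iio i).map (S.orderEmbOfFin rfl).toEmbedding := by
    ext x
    rw [Finset.mem_filter, Finset.mem_map]
    constructor
    · rintro ⟨hxS, hx⟩
      obtain ⟨j, rfl⟩ : ∃ j, S.orderEmbOfFin rfl j = x := by
        rwa [← Set.mem_range, Finset.range_orderEmbOfFin]
      exact ⟨j, Finset.mem_Iio.mpr ((S.orderEmbOfFin rfl).lt_iff_lt.mp hx), rfl⟩
    · rintro ⟨j, hj, rfl⟩
      exact ⟨S.orderEmbOfFin_mem rfl j, (S.orderEmbOfFin rfl).lt_iff_lt.mpr (Finset.mem_Iio.mp hj)⟩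
  rw [h, Finset.card_map, Fin.card_Iio]

/-- The map `[n] → [2p]` sending the `i`-th member of a set of `p` vertices to `2i + 1`, and all
other vertices to even numbers. -/
def separate (S : Finset (Fin (n.len + 1))) : n ⟶ SimplexCategory.mk (2 * S.card) :=
  SimplexCategory.Hom.mk
    ⟨fun j => ⟨(S.filter (· < j)).card + (S.filter (· ≤ j)).card, by
        have h1 := S.card_filter_le (· < j)
        have h2 := S.card_filter_le (· ≤ j)
        change _ < 2 * S.card + 1
        omega⟩,
      fun i j hij => Nat.add_le_add
        (Finset.card_le_card (Finset.monotone_filter_right _ fun _ _ h => h.trans_le hij))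
        (Finset.card_le_card (Finset.monotone_filter_right _ fun _ _ h => h.trans hij))⟩

/-- The `i`-th odd vertex of `[2p]`. -/
def oddVertex {p : ℕ} (i : Fin p) : Fin ((SimplexCategory.mk (2 * p)).len + 1) :=
  ⟨2 * i + 1, by have := i.2; change _ < 2 * p + 1; omega⟩

lemma separate_eq_oddVertex_iff (S : Finset (Fin (n.len + 1))) (j : Fin (n.len + 1))
    (i : Fin S.card) :
    (separate S).toOrderHom j = oddVertex i ↔ j = S.orderEmbOfFin rfl i := by
  have h : (separate S).toOrderHom j = oddVertex i ↔
      (S.filter (· < j)).card + (S.filter (· ≤ j)).card = 2 * i + 1 :=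
    Fin.ext_iff (n := 2 * S.card + 1)
  rw [h, card_filter_le_eq]
  constructor
  · intro hj
    have hjS : j ∈ S := by
      by_contra hjS
      rw [if_neg hjS] at hj
      omega
    obtain ⟨i', rfl⟩ : ∃ i', S.orderEmbOfFin rfl i' = j := by
      rwa [← Set.mem_range, Finset.range_orderEmbOfFin]
    rw [if_pos hjS, card_filter_lt_orderEmbOfFin] at hj
    congr 1
    exact Fin.ext (by omega)
  · rintro rfl
    rw [if_pos (S.orderEmbOfFin_mem rfl i), card_filter_lt_orderEmbOfFin]
    omega

/-- The coordinate functions of the odd vertices of `[2p]`. -/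
def oddCoords (k : Type u) [Field k] (p : ℕ) : List (LamDual k (SimplexCategory.mk (2 * p))) :=
  (List.finRange p).map fun i => Finsupp.basisSingleOne.coord (oddVertex i)

lemma pullback_separate_coord (S : Finset (Fin (n.len + 1))) (i : Fin S.card) :
    pullback (k := k) (separate S) (Finsupp.basisSingleOne.coord (oddVertex i)) =
      Finsupp.basisSingleOne.coord (S.orderEmbOfFin rfl i) := by
  refine Finsupp.lhom_ext' fun j => LinearMap.ext_ring ?_
  have h := separate_eq_oddVertex_iff S j i
  simp [Finsupp.single_apply, h]

lemma map_pullback_oddCoords (S : Finset (Fin (n.len + 1))) :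
    (oddCoords k S.card).map (pullback (separate S)) = vertexCoords S := by
  rw [oddCoords, vertexCoords, coordList, ← Finset.listMap_orderEmbOfFin_finRange S rfl,
    List.map_map, List.map_map]
  exact List.map_congr_left fun i _ => pullback_separate_coord S i

lemma coeffHom_mem_range {A : CosimpAlg k} {C : CDGA k} (φ : A ⟶ (Kalg k).obj C)
    (fs : List (LamDual k n)) (a : A.obj n) :
    coeffHom φ fs a ∈ LinearMap.range (coeffHom φ (oddCoords k fs.length)) := by
  rw [coeffHom_apply, tensor_expansion (evalAt φ n a : TensorLam C n), map_sum]
  refine Submodule.sum_mem _ fun S _ => ?_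
  rw [coeff_tm]
  by_cases hS : S.card = fs.length
  · rw [← hS]
    refine Submodule.smul_mem _ _ ⟨(A.map (separate S)).hom a, ?_⟩
    rw [coeffHom_map, map_pullback_oddCoords, coeffHom_apply]
  · rw [contractList_of_mem fs (lamBasis_mem S) hS, zero_smul]
    exact zero_mem _

lemma deg_le_range_coeffHom {D : CosimpAlg k ⥤ CDGA k} (adj : D ⊣ Kalg k) (A : CosimpAlg k)
    (p : ℕ) :
    (D.obj A).deg p ≤ LinearMap.range (coeffHom (adj.unit.app A) (oddCoords k p)) := by
  refine (deg_le_span_coeffHom adj p).trans (Submodule.span_le.mpr ?_)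
  rintro _ ⟨⟨n, a, fs⟩, rfl, rfl⟩
  exact coeffHom_mem_range _ fs a

end OddCoords

/-! ### Reducedness and finiteness of `D(A)` -/

section Reduced

/-- The algebra `Λⁿ`, graded in non-negative degrees and with zero differential. It serves as a
nonzero target for morphisms of cdgas. -/
def CDGA.lam (k : Type u) [Field k] (n : SimplexCategory) : CDGA k where
  carrier := Lam k n
  deg := lamDeg k n
  d := 0
  d_mem _ _ _ := zero_mem _
  d_d _ := rfl
  leibniz _ _ _ _ := by simp
  comm _ _ _ _ hx hy := lam_comm hx hy

variable {A : CosimpAlg k}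

/-- The morphism from a reduced cosimplicial algebra to another one that factors through `k`. -/
def CosimpAlg.IsReduced.trivialHom (hA : A.IsReduced) (B : CosimpAlg k) : A ⟶ B where
  app n := CommAlgCat.ofHom ((Algebra.ofId k (B.obj n)).comp
    ((AlgEquiv.ofBijective (Algebra.ofId k (A.obj (SimplexCategory.mk 0))) hA).symm.toAlgHom.comp
      (A.map (SimplexCategory.isTerminalZero.from n)).hom))
  naturality m n α := by
    refine CommAlgCat.hom_ext (AlgHom.ext fun a => ?_)
    have h : (A.map (SimplexCategory.isTerminalZero.from n)).hom ((A.map α).hom a) =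
        (A.map (SimplexCategory.isTerminalZero.from m)).hom a := by
      rw [← AlgHom.comp_apply, ← CommAlgCat.hom_comp, ← A.map_comp]
      congr 3
    exact (congrArg (fun b => algebraMap k (B.obj n) ((AlgEquiv.ofBijective
      (Algebra.ofId k (A.obj (SimplexCategory.mk 0))) hA).symm b)) h).trans
        (AlgHom.commutes (B.map α).hom _).symm

variable {D : CosimpAlg k ⥤ CDGA k} (adj : D ⊣ Kalg k)
include adj

lemma nontrivial_of_adj (hA : A.IsReduced) : Nontrivial (D.obj A).carrier :=
  have : Nontrivial (CDGA.lam k (SimplexCategory.mk 0)).carrier :=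
    inferInstanceAs (Nontrivial (Lam k (SimplexCategory.mk 0)))
  (CDGA.Hom.toAlgHom ((adj.homEquiv A (CDGA.lam k (SimplexCategory.mk 0))).symm
    (hA.trivialHom _))).toRingHom.domain_nontrivial

lemma isReduced_of_adj (hA : A.IsReduced) : (D.obj A).IsReduced := by
  have := nontrivial_of_adj adj hA
  refine ⟨(algebraMap k (D.obj A).carrier).injective, fun x hx => ?_⟩
  obtain ⟨a, rfl⟩ := deg_le_range_coeffHom adj A 0 hx
  obtain ⟨r, rfl⟩ := hA.2 a
  refine ⟨r, ?_⟩
  rw [Algebra.algebraMap_eq_smul_one, Algebra.algebraMap_eq_smul_one, map_smul]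
  exact congrArg (r • ·) (coeffHom_one _).symm

end Reduced

section Finiteness

lemma finite_quotient_pow {R S : Type*} [CommRing R] [CommRing S] [Algebra R S] {I : Ideal S}
    (hI : I.FG) [Module.Finite R (S ⧸ I)] (n : ℕ) :
    Module.Finite R (S ⧸ I ^ n) := by
  obtain rfl | hn := eq_or_ne n 0
  · rw [pow_zero, Ideal.one_eq_top]
    infer_instance
  have hle : I ^ n ≤ I := Ideal.pow_le_self hn
  have hker : RingHom.ker (Ideal.Quotient.factorₐ R hle) = I.map (Ideal.Quotient.mk (I ^ n)) :=
    Ideal.Quotient.factor_ker hle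
  refine Module.finite_of_surjective_of_ker_le_nilradical _ (Ideal.Quotient.factor_surjective hle)
    (hker.trans_le ?_) (hker ▸ hI.map _)
  rw [Ideal.map_le_iff_le_comap]
  exact fun x hx => ⟨n, by
    rw [← map_pow]
    exact Ideal.Quotient.eq_zero_iff_mem.mpr (Ideal.pow_mem_pow hx n)⟩

variable {A : CosimpAlg k}

lemma bijective_algebraMap_quotient_augIdeal (hA : A.IsReduced) (n : SimplexCategory) :
    Function.Bijective (algebraMap k (A.obj n ⧸ augIdeal A n)) := by
  let f : A.obj n →ₐ[k] A.obj (SimplexCategory.mk 0) :=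
    (A.map (SimplexCategory.isTerminalZero.from n)).hom
  have hf : Function.Surjective f := fun y => by
    obtain ⟨r, rfl⟩ := hA.2 y
    exact ⟨algebraMap k _ r, f.commutes r⟩
  let e : (A.obj n ⧸ augIdeal A n) ≃ₐ[k] A.obj (SimplexCategory.mk 0) :=
    Ideal.quotientKerAlgEquivOfSurjective hf
  rw [← Function.Bijective.of_comp_iff' e.bijective]
  exact (funext fun r => e.commutes r : e ∘ algebraMap k _ = algebraMap k _) ▸ hA

lemma finiteDimensional_range_coeffHom (hA : reducedFGIdeal k A) {n : SimplexCategory} {C : CDGA k}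
    (φ : A ⟶ (Kalg k).obj C) (fs : List (LamDual k n)) :
    FiniteDimensional k (LinearMap.range (coeffHom φ fs)) := by
  have : Module.Finite k (A.obj n ⧸ augIdeal A n) :=
    Module.Finite.of_surjective (Algebra.linearMap k (A.obj n ⧸ augIdeal A n))
      (bijective_algebraMap_quotient_augIdeal hA.1 n).2
  have := finite_quotient_pow (R := k) (hA.2 n) (fs.length + 1)
  have hker : (augIdeal A n ^ (fs.length + 1)).restrictScalars k ≤ LinearMap.ker (coeffHom φ fs) :=
    fun a ha => coeffHom_of_mem_augIdeal_pow φ fs fs.length.lt_succ_self ha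
  rw [← Submodule.range_liftQ _ _ hker]
  exact Module.Finite.of_surjective ((LinearMap.rangeRestrict _) ∘ₗ
    (Submodule.Quotient.restrictScalarsEquiv k (augIdeal A n ^ (fs.length + 1))).symm.toLinearMap)
    ((LinearMap.surjective_rangeRestrict _).comp (LinearEquiv.surjective _))

lemma reducedFGCDGA_of_adj {D : CosimpAlg k ⥤ CDGA k} (adj : D ⊣ Kalg k)
    (hA : reducedFGIdeal k A) : reducedFGCDGA k (D.obj A) :=
  ⟨isReduced_of_adj adj hA.1, fun p _ =>
    have := finiteDimensional_range_coeffHom hA (adj.unit.app A) (oddCoords k p)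
    Submodule.finiteDimensional_of_le (deg_le_range_coeffHom adj A p)⟩

end Finiteness

/-! ### Complete local algebras -/

section CompleteLocal

lemma isAdicComplete_of_pow_eq_bot {R : Type*} [CommRing R] {I : Ideal R} {N : ℕ}
    (h : I ^ N = ⊥) : IsAdicComplete I R where
  haus' x hx := by
    have := hx N
    rwa [h, Submodule.bot_smul, SModEq.bot] at this
  prec' f hf := by
    refine ⟨f N, fun n => ?_⟩
    obtain hn | hn := le_total n N
    · exact hf hn
    · have hfn := hf hn
      rw [h, Submodule.bot_smul, SModEq.bot] at hfn
      rw [hfn]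

variable {R : Type u} [CommRing R] [Algebra k R] {I : Ideal R}

/-- The proof maps the completed polynomial ring on generators of `I`, a power series ring, onto
`R`; surjectivity can be checked modulo `I`. -/
lemma isNoetherianRing_of_isAdicComplete [IsAdicComplete I R] (hI : I.FG)
    (h : Function.Surjective (algebraMap k (R ⧸ I))) : IsNoetherianRing R := by
  obtain ⟨r, y, hy⟩ := Submodule.fg_iff_exists_fin_generating_family.mp hI
  let ev : MvPolynomial (Fin r) k →ₐ[k] R := MvPolynomial.aeval y
  let L : Ideal (MvPolynomial (Fin r) k) := MvPolynomial.idealOfVars (Fin r) k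
  have hLI : L.map ev = I := by
    refine (Ideal.map_span _ _).trans (Eq.trans ?_ hy)
    rw [← Set.range_comp]
    exact congrArg (fun v => Ideal.span (Set.range v)) (funext (MvPolynomial.aeval_X y))
  have hle : L ≤ I.comap ev := Ideal.map_le_iff_le_comap.mp hLI.le
  let B := AdicCompletion L (MvPolynomial (Fin r) k)
  let f : B →ₐ[k] R := ((AdicCompletion.ofAlgEquiv I).symm.toAlgHom.restrictScalars k).comp
    (completionMap L I ev hle)
  have hf (p : MvPolynomial (Fin r) k) : f (algebraMap _ B p) = ev p :=
    (congrArg (AdicCompletion.ofAlgEquiv I).symm (completionMap_of ev hle p)).trans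
      (AdicCompletion.ofAlgEquiv_symm_of I (ev p))
  have hmap : (L.map (algebraMap _ B)).map (f : B →+* R) = I :=
    (Ideal.map_map _ _).trans ((congrArg (Ideal.map · L) (RingHom.ext hf)).trans hLI)
  have : IsAdicComplete (L.map (algebraMap _ B)) B :=
    AdicCompletion.isAdicComplete_self L (MvPolynomial.idealOfVars_fg (Fin r) k)
  have : IsHausdorff ((L.map (algebraMap _ B)).map (f : B →+* R)) R := by
    rw [hmap]
    infer_instance
  have : IsNoetherianRing B :=
    isNoetherianRing_of_ringEquiv _ (MvPowerSeries.toAdicCompletionAlgEquiv (Fin r) k).toRingEquiv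
  refine isNoetherianRing_of_surjective B R (f : B →+* R)
    (surjective_of_mk_map_comp_surjective (I := L.map (algebraMap _ B)) _ ?_)
  rw [hmap]
  intro z
  obtain ⟨s, rfl⟩ := h z
  exact ⟨algebraMap k B s, congrArg (Ideal.Quotient.mk I) (f.commutes s)⟩

lemma isCompleteLocalNoetherian_of_isAdicComplete [IsAdicComplete I R] (hI : I.FG)
    (h : Function.Bijective (algebraMap k (R ⧸ I))) : IsCompleteLocalNoetherian k R := by
  have hfield : IsField (R ⧸ I) :=
    (RingEquiv.ofBijective _ h).symm.toMulEquiv.isField (Field.toIsField k)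
  have : I.IsMaximal := Ideal.Quotient.maximal_of_isField I hfield
  have hlocal := isLocalRing_of_isAdicComplete_maximal I
  obtain rfl : I = IsLocalRing.maximalIdeal R := IsLocalRing.eq_maximalIdeal inferInstance
  exact ⟨hlocal, isNoetherianRing_of_isAdicComplete hI h.2, inferInstance, h⟩

lemma bijective_algebraMap_quotient_map_adicCompletion (hI : I.FG)
    (h : Function.Bijective (algebraMap k (R ⧸ I))) :
    Function.Bijective (algebraMap k
      (AdicCompletion I R ⧸ I.map (algebraMap R (AdicCompletion I R)))) := by
  let e : (AdicCompletion I R ⧸ I.map (algebraMap R (AdicCompletion I R))) ≃+* R ⧸ I :=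
    (Ideal.quotEquivOfEq (AdicCompletion.ker_evalOneₐ_eq_map I hI).symm).trans
      (RingHom.quotientKerEquivOfSurjective (AdicCompletion.evalOneₐ_surjective I))
  rw [← Function.Bijective.of_comp_iff' e.bijective]
  exact (funext fun r => ((AdicCompletion.evalOneₐ I).restrictScalars k).commutes r :
    e ∘ algebraMap k _ = algebraMap k _) ▸ h

lemma isCompleteLocalNoetherian_adicCompletion (hI : I.FG)
    (h : Function.Bijective (algebraMap k (R ⧸ I))) :
    IsCompleteLocalNoetherian k (AdicCompletion I R) :=
  have := AdicCompletion.isAdicComplete_self I hI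
  isCompleteLocalNoetherian_of_isAdicComplete (hI.map _)
    (bijective_algebraMap_quotient_map_adicCompletion hI h)

end CompleteLocal

/-! ### Completions of reduced cosimplicial algebras -/

section Completion

variable {A : CosimpAlg k}

lemma reducedFGIdeal_of_reducedFG (hA : reducedFG k A) : reducedFGIdeal k A :=
  ⟨hA.1, fun n =>
    have := hA.2 n
    have : IsNoetherianRing (A.obj n) := Algebra.FiniteType.isNoetherianRing k _
    (augIdeal A n).fg_of_isNoetherianRing⟩

lemma reducedFGIdeal_of_reducedComplete (hA : reducedComplete k A) : reducedFGIdeal k A :=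
  ⟨hA.1, fun n =>
    have := (hA.2 n).isNoetherianRing
    (augIdeal A n).fg_of_isNoetherianRing⟩

lemma augIdeal_zero (A : CosimpAlg k) : augIdeal A (SimplexCategory.mk 0) = ⊥ := by
  rw [augIdeal, SimplexCategory.isTerminalZero.hom_ext
    (SimplexCategory.isTerminalZero.from _) (𝟙 _), A.map_id]
  exact (RingHom.injective_iff_ker_eq_bot _).mp Function.injective_id

lemma isReduced_completion (hA : A.IsReduced) : ((completion k).obj A).IsReduced := by
  have : IsAdicComplete (augIdeal A (SimplexCategory.mk 0)) (A.obj (SimplexCategory.mk 0)) := by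
    rw [augIdeal_zero]
    infer_instance
  have h := (AdicCompletion.of_bijective (augIdeal A (SimplexCategory.mk 0)) _).comp hA
  exact h

lemma reducedComplete_completion (hA : reducedFGIdeal k A) :
    reducedComplete k ((completion k).obj A) :=
  ⟨isReduced_completion hA.1, fun n => isCompleteLocalNoetherian_adicCompletion (hA.2 n)
    (bijective_algebraMap_quotient_augIdeal hA.1 n)⟩

lemma isIso_toCompletion (h : ∀ n, IsAdicComplete (augIdeal A n) (A.obj n)) :
    IsIso ((toCompletion k).app A) := by
  have (n : SimplexCategory) : IsIso (((toCompletion k).app A).app n) := by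
    have := h n
    have hbij : Function.Bijective ((forget _).map (((toCompletion k).app A).app n)) :=
      AdicCompletion.of_bijective (augIdeal A n) (A.obj n)
    have := (isIso_iff_bijective _).mpr hbij
    exact isIso_of_reflects_iso _ (forget (CommAlgCat k))
  exact NatIso.isIso_of_isIso_app _

lemma exists_sub_algebraMap_mem_map_pow {R : Type*} [CommRing R] {I : Ideal R} (hI : I.FG)
    (j : ℕ) (x : AdicCompletion I R) :
    ∃ a : R, x - algebraMap R _ a ∈ I.map (algebraMap R (AdicCompletion I R)) ^ j := by
  obtain ⟨a, ha⟩ := Submodule.Quotient.mk_surjective _ (AdicCompletion.eval I R j x)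
  refine ⟨a, ?_⟩
  rw [← Ideal.map_pow, ← Submodule.restrictScalars_mem R, ← Ideal.smul_top_eq_map,
    AdicCompletion.pow_smul_top_eq_ker_eval hI, LinearMap.mem_ker, map_sub, sub_eq_zero]
  exact ha.symm

lemma exists_sub_toCompletion_mem_augIdeal_pow {n : SimplexCategory} (hA : (augIdeal A n).FG)
    (j : ℕ) (x : ((completion k).obj A).obj n) :
    ∃ a : A.obj n, x - (((toCompletion k).app A).app n).hom a ∈
      augIdeal ((completion k).obj A) n ^ j := by
  obtain ⟨a, ha⟩ := exists_sub_algebraMap_mem_map_pow hA j x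
  have hle : (augIdeal A n).map (algebraMap (A.obj n) (AdicCompletion (augIdeal A n) (A.obj n))) ≤
      augIdeal ((completion k).obj A) n :=
    Ideal.map_le_iff_le_comap.mpr (augIdeal_app ((toCompletion k).app A) n)
  exact ⟨a, Ideal.pow_right_mono hle j ha⟩

/-- A morphism `Â ⟶ B` maps `x - a ∈ (𝔪ⁿ)^j Â` into `(𝔪ⁿ)^j = 0`, so it is determined by its
composite with `A ⟶ Â`. -/
lemma bijective_toCompletion_comp (hA : ∀ n, (augIdeal A n).FG) {B : CosimpAlg k}
    (hB : ∀ n, ∃ j, augIdeal B n ^ j = ⊥) :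
    Function.Bijective fun g : (completion k).obj A ⟶ B => (toCompletion k).app A ≫ g := by
  constructor
  · intro g h hgh
    refine NatTrans.ext (funext fun n => CommAlgCat.hom_ext (AlgHom.ext fun x => ?_))
    obtain ⟨j, hj⟩ := hB n
    obtain ⟨a, ha⟩ := exists_sub_toCompletion_mem_augIdeal_pow (hA n) j x
    have app_eq (g : (completion k).obj A ⟶ B) :
        (g.app n).hom x = (((toCompletion k).app A ≫ g).app n).hom a := by
      have hg := Ideal.le_comap_pow _ j (Ideal.pow_right_mono (augIdeal_app g n) j ha)
      rw [hj, Ideal.mem_comap, Ideal.mem_bot, map_sub, sub_eq_zero] at hg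
      exact hg
    rw [app_eq g, app_eq h]
    exact congrArg (fun f : A ⟶ B => (f.app n).hom a) hgh
  · intro φ
    have : IsIso ((toCompletion k).app B) := isIso_toCompletion fun n =>
      isAdicComplete_of_pow_eq_bot (hB n).choose_spec
    refine ⟨(completion k).map φ ≫ inv ((toCompletion k).app B), ?_⟩
    exact (Category.assoc _ _ _).symm.trans
      ((IsIso.comp_inv_eq _).mpr ((toCompletion k).naturality φ).symm)

lemma isIso_map_toCompletion {D : CosimpAlg k ⥤ CDGA k} (adj : D ⊣ Kalg k)
    (hA : ∀ n, (augIdeal A n).FG) : IsIso (D.map ((toCompletion k).app A)) := by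
  refine isIso_of_coyoneda_map_bijective _ fun C => ?_
  have hbij := bijective_toCompletion_comp hA fun n => ⟨_, augIdeal_Kalg_pow C n⟩
  rw [← Function.Bijective.of_comp_iff' (adj.homEquiv A C).bijective]
  refine (iff_of_eq (congrArg _ (funext fun g => ?_))).mp
    (hbij.comp (adj.homEquiv ((completion k).obj A) C).bijective)
  exact (adj.homEquiv_naturality_left _ _).symm

end Completion

/-! ### The values of `K` at reduced cdgas -/

section KValues

variable {C : CDGA k}

lemma vertexCoords_singleton_zero :
    (vertexCoords {0} : List (LamDual k (SimplexCategory.mk 0))) =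
      [lamFunctional k (SimplexCategory.mk 0)] := by
  have hcoord : Finsupp.basisSingleOne.coord (0 : Fin 1) =
      lamFunctional k (SimplexCategory.mk 0) := by
    refine Finsupp.lhom_ext' fun i => LinearMap.ext_ring ?_
    obtain rfl : i = 0 := Subsingleton.elim (α := Fin 1) _ _
    simp [lamFunctional]
  rw [vertexCoords, coordList, Finset.sort_singleton, List.map_singleton]
  exact congrArg (fun f => [f]) hcoord

/-- The coefficient at `e₀` of a cocycle `a + b e₀` is determined by `b = d a`. -/
lemma kSubalgebra_zero_ext {s t : kSubalgebra C (SimplexCategory.mk 0)}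
    (h : coeff [] (s : TensorLam C (SimplexCategory.mk 0)) = coeff [] t.1) : s = t := by
  refine Subtype.ext (tensor_ext fun S => ?_)
  obtain rfl | rfl := Finset.subset_singleton_iff.mp
    (fun i _ => Finset.mem_singleton.mpr (Subsingleton.elim (α := Fin 1) i 0) : S ⊆ {0})
  · simpa [vertexCoords, coordList] using h
  · have hs := d_coeff [] s
    have ht := d_coeff [] t
    rw [List.length_nil, pow_zero, one_smul] at hs ht
    rw [vertexCoords_singleton_zero, ← hs, ← ht, h]

lemma coeff_nil_algebraMap {n : SimplexCategory} (r : k) :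
    coeff [] ((algebraMap k (kSubalgebra C n) r : kSubalgebra C n) : TensorLam C n) =
      algebraMap k C.carrier r := by
  have h : ((algebraMap k (kSubalgebra C n) r : kSubalgebra C n) : TensorLam C n) =
      r • tm C n 1 1 := Algebra.algebraMap_eq_smul_one r
  rw [h, map_smul, coeff_tm, contractList_nil, map_one, one_smul, Algebra.algebraMap_eq_smul_one]

lemma isReduced_Kalg (hC : C.IsReduced) : ((Kalg k).obj C).IsReduced := by
  refine ⟨fun r s hrs => hC.1 ?_, fun t => ?_⟩
  · rw [← coeff_nil_algebraMap (n := SimplexCategory.mk 0), ← coeff_nil_algebraMap]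
    exact congrArg (fun t : kSubalgebra C (SimplexCategory.mk 0) => coeff [] t.1) hrs
  · let t' : kSubalgebra C (SimplexCategory.mk 0) := t
    obtain ⟨r, hr⟩ := hC.2 _ (coeff_mem [] t'.2.1)
    exact ⟨r, kSubalgebra_zero_ext ((coeff_nil_algebraMap r).trans hr)⟩

lemma finiteDimensional_deg (hC : reducedFGCDGA k C) (i : ℕ) : FiniteDimensional k (C.deg i) := by
  obtain rfl | hi := Nat.eq_zero_or_pos i
  · have hle : C.deg 0 ≤ LinearMap.range (Algebra.linearMap k C.carrier) := hC.1.2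
    exact Submodule.finiteDimensional_of_le hle
  · exact hC.2 i hi

lemma finiteDimensional_kSubalgebra (hC : reducedFGCDGA k C) (n : SimplexCategory) :
    FiniteDimensional k (kSubalgebra C n) := by
  have := finiteDimensional_deg hC
  let coords : kSubalgebra C n →ₗ[k] ∀ S : Finset (Fin (n.len + 1)),
      C.deg (vertexCoords S : List (LamDual k n)).length :=
    LinearMap.pi fun S => LinearMap.codRestrict _
      (coeff (vertexCoords S) ∘ₗ (kSubalgebra C n).val.toLinearMap) fun t => coeff_mem _ t.2.1
  exact FiniteDimensional.of_injective coords fun s t hst =>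
    Subtype.ext (tensor_ext fun S => congrArg Subtype.val (congrFun hst S))

lemma reducedFG_Kalg (hC : reducedFGCDGA k C) : reducedFG k ((Kalg k).obj C) :=
  ⟨isReduced_Kalg hC.1, fun n =>
    have := finiteDimensional_kSubalgebra hC n
    (inferInstance : Algebra.FiniteType k (kSubalgebra C n))⟩

lemma isAdicComplete_Kalg (C : CDGA k) (n : SimplexCategory) :
    IsAdicComplete (augIdeal ((Kalg k).obj C) n) (((Kalg k).obj C).obj n) :=
  isAdicComplete_of_pow_eq_bot (augIdeal_Kalg_pow C n)

lemma reducedComplete_Kalg (hC : reducedFGCDGA k C) : reducedComplete k ((Kalg k).obj C) :=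
  have hK := reducedFGIdeal_of_reducedFG (reducedFG_Kalg hC)
  ⟨hK.1, fun n =>
    have := isAdicComplete_Kalg C n
    isCompleteLocalNoetherian_of_isAdicComplete (hK.2 n)
      (bijective_algebraMap_quotient_augIdeal hK.1 n)⟩

end KValues

/-! ### Restriction to full subcategories -/

section Restriction

variable {X Y Z : Type*} [Category X] [Category Y] [Category Z] {P : ObjectProperty X}
  {Q : ObjectProperty Y} {R : ObjectProperty Z}

lemma exists_restrict_adjunction {F : X ⥤ Y} {G : Y ⥤ X} (adj : F ⊣ G)
    (hF : ∀ A, P A → Q (F.obj A)) (hG : ∀ C, Q C → P (G.obj C)) :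
    ∃ adj' : restrict F hF ⊣ restrict G hG,
      (∀ A, (adj'.unit.app A).hom = adj.unit.app A.obj) ∧
      (∀ C, (adj'.counit.app C).hom = adj.counit.app C.obj) := by
  let e₁ : P.ι ⋙ F ≅ restrict F hF ⋙ Q.ι := Iso.refl _
  let e₂ : Q.ι ⋙ G ≅ restrict G hG ⋙ P.ι := Iso.refl _
  refine ⟨adj.restrictFullyFaithful P.fullyFaithfulι Q.fullyFaithfulι e₁ e₂,
    fun A => ?_, fun C => ?_⟩
  · simpa [e₁, e₂] using
      adj.map_restrictFullyFaithful_unit_app P.fullyFaithfulι Q.fullyFaithfulι e₁ e₂ A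
  · simpa [e₁, e₂] using
      adj.map_restrictFullyFaithful_counit_app P.fullyFaithfulι Q.fullyFaithfulι e₁ e₂ C

lemma exists_iso_of_isIso_app {F G : X ⥤ Y} (τ : G ⟶ F) (h : ∀ A, IsIso (τ.app A)) :
    ∃ e : F ≅ G, ∀ A, e.inv.app A = τ.app A :=
  have := NatIso.isIso_of_isIso_app τ
  ⟨(asIso τ).symm, fun _ => rfl⟩

lemma exists_restrict_iso {F : X ⥤ Y} {G : Y ⥤ Z} {H : X ⥤ Z} (hF : ∀ A, P A → Q (F.obj A))
    (hG : ∀ A, Q A → R (G.obj A)) (hH : ∀ A, P A → R (H.obj A)) (τ : H ⟶ F ⋙ G)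
    (h : ∀ A, P A → IsIso (τ.app A)) :
    ∃ e : restrict F hF ⋙ restrict G hG ≅ restrict H hH,
      ∀ A, (e.inv.app A).hom = τ.app A.obj := by
  let σ : restrict H hH ⟶ restrict F hF ⋙ restrict G hG :=
    { app := fun A => ObjectProperty.homMk (τ.app A.obj)
      naturality := fun A B f => ObjectProperty.hom_ext _ (τ.naturality f.hom) }
  obtain ⟨e, he⟩ := exists_iso_of_isIso_app σ fun A =>
    (R.isIso_hom_iff _).mp (h A.obj A.property)
  exact ⟨e, fun A => congrArg _ (he A)⟩

end Restriction

end CosimplicialDK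

end

theorem mainTheorem11_general (k : Type u) [Field k] :
    (Kalg k).IsRightAdjoint ∧
    ∀ (D : CosimpAlg k ⥤ CDGA k) (adj : D ⊣ Kalg k),
      ∃ (hD : ∀ A, reducedFG k A → reducedFGCDGA k (D.obj A))
        (hK : ∀ C, reducedFGCDGA k C → reducedFG k ((Kalg k).obj C))
        (hc : ∀ A, reducedFG k A → reducedComplete k ((completion k).obj A))
        (hD' : ∀ A, reducedComplete k A → reducedFGCDGA k (D.obj A))
        (hK' : ∀ C, reducedFGCDGA k C → reducedComplete k ((Kalg k).obj C)),
        (∃ adj₁ : restrict D hD ⊣ restrict (Kalg k) hK,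
          (∀ A, (adj₁.unit.app A).hom = adj.unit.app A.obj) ∧
          (∀ C, (adj₁.counit.app C).hom = adj.counit.app C.obj)) ∧
        (∀ A : CosimpAlg k, A.IsReduced →
          (D.obj A).IsReduced ∧ (D.obj ((completion k).obj A)).IsReduced) ∧
        (∃ e : (reducedFGIdeal k).ι ⋙ completion k ⋙ D ≅ (reducedFGIdeal k).ι ⋙ D,
          ∀ A, e.inv.app A = D.map ((toCompletion k).app A.obj)) ∧
        (∃ adj₂ : restrict D hD' ⊣ restrict (Kalg k) hK',
          (∀ A, (adj₂.unit.app A).hom = adj.unit.app A.obj) ∧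
          (∀ C, (adj₂.counit.app C).hom = adj.counit.app C.obj)) ∧
        (∃ e : restrict (completion k) hc ⋙ restrict D hD' ≅ restrict D hD,
          ∀ A, (e.inv.app A).hom = D.map ((toCompletion k).app A.obj)) ∧
        (∃ e : restrict (Kalg k) hK ⋙ restrict (completion k) hc ≅ restrict (Kalg k) hK',
          ∀ C, (e.inv.app C).hom = (toCompletion k).app ((Kalg k).obj C.obj)) := by
  refine ⟨isRightAdjoint_Kalg k, fun D adj => ?_⟩
  let mapToCompletion : D ⟶ completion k ⋙ D := Functor.whiskerRight (toCompletion k) D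
  have hmap (A : CosimpAlg k) (hA : reducedFGIdeal k A) : IsIso (mapToCompletion.app A) :=
    isIso_map_toCompletion adj hA.2
  exact ⟨fun A hA => reducedFGCDGA_of_adj adj (reducedFGIdeal_of_reducedFG hA),
    fun C hC => reducedFG_Kalg hC,
    fun A hA => reducedComplete_completion (reducedFGIdeal_of_reducedFG hA),
    fun A hA => reducedFGCDGA_of_adj adj (reducedFGIdeal_of_reducedComplete hA),
    fun C hC => reducedComplete_Kalg hC,
    exists_restrict_adjunction adj _ _,
    fun A hA => ⟨isReduced_of_adj adj hA, isReduced_of_adj adj (isReduced_completion hA)⟩,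
    exists_iso_of_isIso_app (Functor.whiskerLeft (reducedFGIdeal k).ι mapToCompletion)
      fun A => hmap A.obj A.property,
    exists_restrict_adjunction adj _ _,
    exists_restrict_iso _ _ _ mapToCompletion fun A hA => hmap A (reducedFGIdeal_of_reducedFG hA),
    exists_restrict_iso _ _ _ (Functor.whiskerLeft (Kalg k) (toCompletion k)) fun C _ =>
      isIso_toCompletion (isAdicComplete_Kalg C)⟩

theorem mainTheorem11 (k : Type u) [Field k] [CharZero k] :
    (Kalg k).IsRightAdjoint ∧
    ∀ (D : CosimpAlg k ⥤ CDGA k) (adj : D ⊣ Kalg k),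
      ∃ (hD : ∀ A, reducedFG k A → reducedFGCDGA k (D.obj A))
        (hK : ∀ C, reducedFGCDGA k C → reducedFG k ((Kalg k).obj C))
        (hc : ∀ A, reducedFG k A → reducedComplete k ((completion k).obj A))
        (hD' : ∀ A, reducedComplete k A → reducedFGCDGA k (D.obj A))
        (hK' : ∀ C, reducedFGCDGA k C → reducedComplete k ((Kalg k).obj C)),
        -- the adjunction restricts to finitely generated reduced algebras
        (∃ adj₁ : restrict D hD ⊣ restrict (Kalg k) hK,
          (∀ A, (adj₁.unit.app A).hom = adj.unit.app A.obj) ∧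
          (∀ C, (adj₁.counit.app C).hom = adj.counit.app C.obj)) ∧
        -- `D` is invariant under completion
        (∀ A : CosimpAlg k, A.IsReduced →
          (D.obj A).IsReduced ∧ (D.obj ((completion k).obj A)).IsReduced) ∧
        (∃ e : (reducedFGIdeal k).ι ⋙ completion k ⋙ D ≅ (reducedFGIdeal k).ι ⋙ D,
          ∀ A, e.inv.app A = D.map ((toCompletion k).app A.obj)) ∧
        -- the adjunction extends along the completion functor
        (∃ adj₂ : restrict D hD' ⊣ restrict (Kalg k) hK',
          (∀ A, (adj₂.unit.app A).hom = adj.unit.app A.obj) ∧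
          (∀ C, (adj₂.counit.app C).hom = adj.counit.app C.obj)) ∧
        (∃ e : restrict (completion k) hc ⋙ restrict D hD' ≅ restrict D hD,
          ∀ A, (e.inv.app A).hom = D.map ((toCompletion k).app A.obj)) ∧
        (∃ e : restrict (Kalg k) hK ⋙ restrict (completion k) hc ≅ restrict (Kalg k) hK',
          ∀ C, (e.inv.app C).hom = (toCompletion k).app ((Kalg k).obj C.obj)) :=
  mainTheorem11_general k
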